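/- Call a placement of the vertices of a finite directed acyclic graph $G$ at distinct points of $\mathbb{Z}^2$ an \emph{upward drawing} of $G$ if, drawing each edge as a straight-line segment, no edge passes through a vertex other than its endpoints, two distinct edges meet at most in common endpoints, and for every edge $v\to w$ the $y$-coordinate of $v$ is smaller than that of $w$. It has \emph{height at most} $h$ if, up to translation, it lies on the grid $[1,w]\times[1,h]$ for some $w$. An \emph{integer programming formulation} consists of finitely many families of integer variables and finitely many families of linear inequality constraints, each family indexed by all $k$-tuples of vertices of the input graph (with $k$ depending on the family), and a linear objective function to be minimized. The coefficient of a variable in a constraint, the right-hand side of a constraint and the objective coefficient of a variable are polynomials in the number $n$ of vertices, chosen from a fixed table, independent of the graph, according only to which of the vertices indexing the constraint and/or variable concerned are equal and which of them are joined by directed edges. There exist an integer programming formulation and a constant $C$ such that for every finite directed acyclic graph $G$ with $n$ vertices (in particular, for every planar one) the resulting integer program has the following properties. (a) If $n\ge 1$, it has at most $Cn^3$ variables and at most $Cn^3$ constraints. (b) It is feasible if and only if $G$ has an upward drawing. (c) If $G$ has an upward drawing, then the program has an optimal solution. The objective value of every optimal solution is the minimum height of an upward drawing of $G$, and every optimal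 solution describes an upward drawing of that height: there are two fixed families of variables $X_v$, $Y_v$ ($v\in V(G)$) such that $G$ has an upward drawing of minimum height in which every vertex $v$ has $y$-coordinate $Y_v$ and in which, of any two vertices in the same row, $u$ is to the left of $v$ if and only if $X_u<X_v$. -/

import Mathlib

/-! ### Directed acyclic graphs and their upward drawings -/

/-- A directed graph is acyclic if it has no directed cycle (so no loops and no 2-cycles either). -/
def IsDAG {V : Type*} (G : Digraph V) : Prop :=
  ∀ v : V, ¬ Relation.TransGen G.Adj v v

/-- An integer grid point as a point of the real plane. -/
def toPlane (p : ℤ × ℤ) : ℝ × ℝ := ((p.1 : ℝ), (p.2 : ℝ))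

/-- The straight-line segment that represents the edge from `v` to `w`. -/
def edgeSegment {V : Type*} (pos : V → ℤ × ℤ) (v w : V) : Set (ℝ × ℝ) :=
  segment ℝ (toPlane (pos v)) (toPlane (pos w))

/-- Placing every vertex `v` at the grid point `pos v` and drawing every edge as a straight-line
segment gives a planar drawing: no two elements of the drawing intersect unless the corresponding
elements of the graph do. -/
structure IsPlanarStraightLineDrawing {V : Type*} (G : Digraph V) (pos : V → ℤ × ℤ) : Prop where
  /-- no two vertices coincide -/
  vertex_vertex : Function.Injective pos
  /-- no edge passes through a vertex other than its endpoints -/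
  vertex_edge : ∀ u v w : V, G.Adj v w → u ≠ v → u ≠ w →
    toPlane (pos u) ∉ edgeSegment pos v w
  /-- two distinct edges meet at most in common endpoints -/
  edge_edge : ∀ v w v' w' : V, G.Adj v w → G.Adj v' w' → (v, w) ≠ (v', w') →
    ∀ p ∈ edgeSegment pos v w ∩ edgeSegment pos v' w',
      ∃ u : V, (u = v ∨ u = w) ∧ (u = v' ∨ u = w') ∧ p = toPlane (pos u)

/-- An upward (planar) drawing: a planar straight-line drawing on the integer grid in which every
directed edge `v → w` has the `y`-coordinate of `v` smaller than that of `w`. -/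
structure IsUpwardDrawing {V : Type*} (G : Digraph V) (pos : V → ℤ × ℤ) : Prop where
  planar : IsPlanarStraightLineDrawing G pos
  upward : ∀ v w : V, G.Adj v w → (pos v).2 < (pos w).2

/-- After a translation, the drawing lies on the `[1, w] × [1, h]` grid. -/
def FitsGrid {V : Type*} (pos : V → ℤ × ℤ) (w h : ℕ) : Prop :=
  ∃ a b : ℤ, ∀ v : V,
    (pos v).1 + a ∈ Set.Icc (1 : ℤ) w ∧ (pos v).2 + b ∈ Set.Icc (1 : ℤ) h

/-- `G` has an upward drawing. -/
def HasUpwardDrawing {V : Type*} (G : Digraph V) : Prop :=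
  ∃ pos : V → ℤ × ℤ, IsUpwardDrawing G pos

/-- `G` has an upward drawing that occupies (at most) `h` consecutive rows of the grid. -/
def HasUpwardDrawingOfHeight {V : Type*} (G : Digraph V) (h : ℕ) : Prop :=
  ∃ (pos : V → ℤ × ℤ) (w : ℕ), IsUpwardDrawing G pos ∧ FitsGrid pos w h

/-! ### Integer programs -/

/-- The integer linear program "minimize `cost ⬝ᵥ x` subject to `A *ᵥ x ≤ b`, `x` integral", with
variables indexed by `ι` and constraints indexed by `κ`. -/
structure IntegerProgram (ι κ : Type*) where
  A : Matrix κ ι ℤ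
  b : κ → ℤ
  cost : ι → ℤ

namespace IntegerProgram

variable {ι κ : Type*} [Fintype ι]

/-- `x` satisfies all constraints. -/
def IsFeasible (P : IntegerProgram ι κ) (x : ι → ℤ) : Prop :=
  P.A.mulVec x ≤ P.b

/-- The value of the objective function at `x`. -/
def objective (P : IntegerProgram ι κ) (x : ι → ℤ) : ℤ :=
  dotProduct P.cost x

/-- `x` is a feasible solution of minimum objective value. -/
def IsOptimal (P : IntegerProgram ι κ) (x : ι → ℤ) : Prop :=
  P.IsFeasible x ∧ ∀ x' : ι → ℤ, P.IsFeasible x' → P.objective x ≤ P.objective x'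

end IntegerProgram

/-! ### Integer programming formulations

A *formulation* is one fixed finite recipe that writes down an integer program for every input
graph. It consists of finitely many families of variables `x^f_{t₁, …, t_k}` and finitely many
families of constraints, indexed by tuples of vertices of the graph. The coefficient of a variable
in a constraint is looked up in a finite table that does not depend on the graph: it only sees
which of the vertices that index the variable and the constraint coincide and which of them are
joined by edges. The table's entries are polynomials in the number `n` of vertices (this allows for
constants such as grid sizes and "big M"s). In particular the program of a graph is obtained from
the graph by purely local inspection and has integer coefficients of polynomial magnitude, so that
the answer to the question about the graph cannot be precomputed in the recipe. -/

/-- What can be seen of a tuple of vertices: which entries coincide and which are joined by an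
edge. For a finite index type there are finitely many patterns. -/
structure VertexPattern (I : Type) where
  same : I → I → Prop
  adj : I → I → Prop

/-- The pattern of the tuple `z` in the graph `G`. -/
def vertexPattern {V : Type*} (G : Digraph V) {I : Type} (z : I → V) : VertexPattern I where
  same i j := z i = z j
  adj i j := G.Adj (z i) (z j)

/-- A uniform integer programming formulation for problems on directed graphs. -/
structure IPFormulation where
  /-- the number of families of variables -/
  numVar : ℕ
  /-- how many vertices index a variable of each family -/
  varArity : Fin numVar → ℕ
  /-- the number of families of constraints -/
  numCon : ℕ
  /-- how many vertices index a constraint of each family -/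
  conArity : Fin numCon → ℕ
  /-- the coefficient of a variable in a constraint, as a polynomial in `n` -/
  coeff : (c : Fin numCon) → (f : Fin numVar) →
    VertexPattern (Fin (conArity c) ⊕ Fin (varArity f)) → Polynomial ℤ
  /-- the right-hand side of a constraint, as a polynomial in `n` -/
  rhs : (c : Fin numCon) → VertexPattern (Fin (conArity c)) → Polynomial ℤ
  /-- the objective coefficient of a variable, as a polynomial in `n` -/
  cost : (f : Fin numVar) → VertexPattern (Fin (varArity f)) → Polynomial ℤ

namespace IPFormulation

/-- The variables of the program for a graph with vertex set `V`. -/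
abbrev Var (S : IPFormulation) (V : Type*) : Type _ :=
  Σ f : Fin S.numVar, (Fin (S.varArity f) → V)

/-- The constraints of the program for a graph with vertex set `V`. -/
abbrev Con (S : IPFormulation) (V : Type*) : Type _ :=
  Σ c : Fin S.numCon, (Fin (S.conArity c) → V)

/-- The integer program that the formulation `S` writes down for the graph `G`. -/
noncomputable def program (S : IPFormulation) {V : Type*} [Fintype V] (G : Digraph V) :
    IntegerProgram (S.Var V) (S.Con V) where
  A := Matrix.of fun c f =>
    (S.coeff c.1 f.1 (vertexPattern G (Sum.elim c.2 f.2))).eval (Fintype.card V : ℤ)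
  b c := (S.rhs c.1 (vertexPattern G c.2)).eval (Fintype.card V : ℤ)
  cost f := (S.cost f.1 (vertexPattern G f.2)).eval (Fintype.card V : ℤ)

/-- The variable of the family `f` that belongs to the single vertex `v`. -/
def vertexVar (S : IPFormulation) {V : Type*} (f : Fin S.numVar) (v : V) : S.Var V :=
  ⟨f, fun _ => v⟩

end IPFormulation

/-! That a vertex lies beside a straight edge is a condition quadratic in the coordinates once the
rows vary. In a visibility representation, where vertices are horizontal and edges vertical
segments, it is a comparison of integers, which a big-M constraint makes linear. The program
therefore minimises the height of a visibility representation, and the theorem rests on the fact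
that straight-line and visibility drawings with the same rows can be turned into each other.

From a straight-line drawing, order vertices and edges by "left of in some common row". This
relation has no cycles (`exists_leftmost`), so a numbering up to `n ^ 2` extends it. An edge stands
at its number, and a vertex spans its own number and those of its incident edges.

Conversely, fix the rows. The requirements on the `x`-coordinates are then strict homogeneous linear
inequalities. If they have no solution, Gordan's alternative yields a nonzero stress: loads with
prescribed signs, in equilibrium, between the vertices and the items beside them. Regard the edges
as beams and add up the bending moments of the beams to the left of a gap between columns. The
resulting function has bounded support, is concave in the row away from vertex segments, and changes
from gap to gap only across an edge. A minimum principle makes it nonnegative, and following its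
support from the left makes it zero (`eq_zero_of_concave`). Then no load is left (`stress_eq_zero`),
a contradiction.

Finally, a visibility representation depends only on the order of the rows, so empty rows can be
removed. All coordinates are then bounded by `n ^ 2`, which provides the big M. -/

/-! ### Systems of strict linear inequalities -/

/-- Gordan's alternative: a hyperplane separates the origin from the compact convex hull of the `φ
k` unless the origin belongs to it. -/
theorem exists_forall_pos_or_exists_convex_combination_eq_zero {V K : Type*} [Fintype V] [Fintype K]
    (φ : K → V → ℝ) :
    (∃ x : V → ℝ, ∀ k, 0 < ∑ v, φ k v * x v) ∨
      ∃ f : K → ℝ, (∀ k, 0 ≤ f k) ∧ ∑ k, f k = 1 ∧ ∀ v, ∑ k, f k * φ k v = 0 := by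
  classical
  set T : (K → ℝ) →ₗ[ℝ] V → ℝ := Fintype.linearCombination ℝ φ with hT
  have hTv : ∀ f v, T f v = ∑ k, f k * φ k v := by
    intro f v
    simp [hT, Fintype.linearCombination_apply]
  by_cases h0 : (0 : V → ℝ) ∈ T '' stdSimplex ℝ K
  · right
    obtain ⟨f, hf, h0⟩ := h0
    exact ⟨f, hf.1, hf.2, fun v => by rw [← hTv, h0]; rfl⟩
  · left
    have hc : IsCompact (T '' stdSimplex ℝ K) :=
      (isCompact_stdSimplex ℝ K).image T.continuous_of_finiteDimensional
    obtain ⟨l, u, hl, hu⟩ := geometric_hahn_banach_point_closed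
      ((convex_stdSimplex ℝ K).linear_image T) hc.isClosed h0
    refine ⟨fun v => l (Pi.single v 1), fun k => ?_⟩
    have h1 := hu (φ k) ⟨Pi.single k 1, single_mem_stdSimplex ℝ k, by
      simp [hT, Fintype.linearCombination_apply_single]⟩
    have h2 : l (φ k) = ∑ v, φ k v * l (Pi.single v 1) := by
      conv_lhs => rw [← Finset.univ_sum_single (φ k)]
      rw [map_sum]
      refine Finset.sum_congr rfl fun v _ => ?_
      rw [← smul_eq_mul, ← map_smul, ← Pi.single_smul, smul_eq_mul, mul_one]
    rw [map_zero] at hl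
    rw [← h2]
    linarith

/-- By homogeneity a solution can be scaled until each value exceeds the largest possible rounding
error `∑ v, |φ k v|`; then rounding down is harmless. -/
theorem exists_int_forall_pos {V K : Type*} [Fintype V] [Fintype K] (φ : K → V → ℝ)
    (x : V → ℝ) (hx : ∀ k, 0 < ∑ v, φ k v * x v) :
    ∃ z : V → ℤ, ∀ k, 0 < ∑ v, φ k v * z v := by
  obtain ⟨N, hN⟩ : ∃ N : ℕ, ∀ k, (∑ v, |φ k v|) / (∑ v, φ k v * x v) < N := by
    obtain ⟨B, hB⟩ := (Set.finite_range fun k =>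
      (∑ v, |φ k v|) / (∑ v, φ k v * x v)).bddAbove
    obtain ⟨N, hN⟩ := exists_nat_gt B
    exact ⟨N, fun k => (hB ⟨k, rfl⟩).trans_lt hN⟩
  refine ⟨fun v => ⌊N * x v⌋, fun k => ?_⟩
  have h1 := (div_lt_iff₀ (hx k)).1 (hN k)
  have h2 : ∑ v, (φ k v * (N * x v) - |φ k v|) ≤ ∑ v, φ k v * (⌊N * x v⌋ : ℝ) := by
    refine Finset.sum_le_sum fun v _ => ?_
    have h3 : φ k v * Int.fract (N * x v) ≤ |φ k v| * 1 :=
      (mul_le_mul_of_nonneg_right (le_abs_self _) (Int.fract_nonneg _)).trans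
        (mul_le_mul_of_nonneg_left (Int.fract_lt_one _).le (abs_nonneg _))
    have h4 : φ k v * (N * x v) = φ k v * ⌊N * x v⌋ + φ k v * Int.fract (N * x v) := by
      rw [← mul_add, Int.floor_add_fract]
    linarith
  have h5 : ∑ v, (φ k v * (N * x v) - |φ k v|) = N * ∑ v, φ k v * x v - ∑ v, |φ k v| := by
    rw [Finset.sum_sub_distrib, Finset.mul_sum]
    congr 1
    exact Finset.sum_congr rfl fun v _ => by ring
  linarith

/-! ### Concave functions on a visibility representation -/

/-- A visibility representation: every vertex `v` is a horizontal segment `[L v, R v]` in the row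
`y v`, and every edge `v → w` is a vertical segment at `X v w` that joins the segments of its
endpoints and avoids all others. -/
structure IsVisibilityRepresentation {V : Type*} (G : Digraph V) (y L R : V → ℤ)
    (X : V → V → ℤ) : Prop where
  le : ∀ v, L v ≤ R v
  upward : ∀ v w, G.Adj v w → y v < y w
  left_le_tail : ∀ v w, G.Adj v w → L v ≤ X v w
  tail_le_right : ∀ v w, G.Adj v w → X v w ≤ R v
  left_le_head : ∀ v w, G.Adj v w → L w ≤ X v w
  head_le_right : ∀ v w, G.Adj v w → X v w ≤ R w
  vertex_vertex : ∀ u v, u ≠ v → y u = y v → R u < L v ∨ R v < L u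
  vertex_edge : ∀ u v w, G.Adj v w → u ≠ v → u ≠ w → y v ≤ y u → y u ≤ y w →
    X v w < L u ∨ R u < X v w

/-- The grid position `(c - 1/2, s)` lies in no segment of a vertex. -/
def IsClearAt {V : Type*} (y L R : V → ℤ) (c s : ℤ) : Prop :=
  ∀ v, y v = s → L v < c → R v < c

/-- A nonnegative function that is concave on the interior of an interval and vanishes at an
interior point vanishes on the interval. -/
theorem eq_zero_of_concave_of_nonneg {f : ℤ → ℝ} {a b s₀ : ℤ} (hf : ∀ s, 0 ≤ f s)
    (hc : ∀ s, a < s → s < b → f (s + 1) + f (s - 1) ≤ 2 * f s)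
    (ha : a < s₀) (hb : s₀ < b) (h0 : f s₀ = 0) (s : ℤ) (has : a ≤ s) (hsb : s ≤ b) :
    f s = 0 := by
  have up : ∀ n : ℕ, s₀ + n ≤ b → f (s₀ + n) = 0 := by
    intro n
    induction n with
    | zero => intro _; simpa using h0
    | succ n ih =>
      intro hn
      push_cast at hn ⊢
      have h1 := hc (s₀ + n) (by omega) (by omega)
      rw [ih (by omega)] at h1
      have h2 := hf (s₀ + n + 1)
      have h3 := hf (s₀ + n - 1)
      rw [← add_assoc]
      linarith
  have down : ∀ n : ℕ, a ≤ s₀ - n → f (s₀ - n) = 0 := by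
    intro n
    induction n with
    | zero => intro _; simpa using h0
    | succ n ih =>
      intro hn
      push_cast at hn ⊢
      have h1 := hc (s₀ - n) (by omega) (by omega)
      rw [ih (by omega)] at h1
      have h2 := hf (s₀ - n + 1)
      have h3 := hf (s₀ - n - 1)
      rw [← sub_sub]
      linarith
  rcases le_total s₀ s with h | h
  · obtain ⟨n, rfl⟩ := Int.le.dest h
    exact up n hsb
  · obtain ⟨n, hn⟩ := Int.le.dest h
    have : s = s₀ - n := by omega
    subst this
    exact down n has

namespace IsVisibilityRepresentation

variable {V : Type*} {G : Digraph V} {y L R : V → ℤ} {X : V → V → ℤ}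

theorem isClearAt_left (h : IsVisibilityRepresentation G y L R X) (v : V) :
    IsClearAt y L R (L v) (y v) := by
  intro u hu huv
  have hne : u ≠ v := by rintro rfl; exact lt_irrefl _ huv
  have := h.vertex_vertex u v hne hu
  have := h.le v
  omega

theorem isClearAt_right (h : IsVisibilityRepresentation G y L R X) (v : V) :
    IsClearAt y L R (R v + 1) (y v) := by
  intro u hu huv
  by_cases hne : u = v
  · subst hne; omega
  have := h.vertex_vertex u v hne hu
  have := h.le v
  omega

theorem isClearAt_edge (h : IsVisibilityRepresentation G y L R X) {v w : V} (e : G.Adj v w)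
    {s : ℤ} (h1 : y v < s) (h2 : s < y w) :
    IsClearAt y L R (X v w) s ∧ IsClearAt y L R (X v w + 1) s := by
  constructor <;> intro u hu hl <;>
  · have := h.vertex_edge u v w e (by rintro rfl; omega) (by rintro rfl; omega)
      (by omega) (by omega)
    omega

/-- The columns of `F` differ only where an edge separates them. -/
theorem apply_left_of_jump (h : IsVisibilityRepresentation G y L R X) {F : ℤ → ℤ → ℝ}
    (jump : ∀ c s, F (c + 1) s ≠ F c s → ∃ v w, G.Adj v w ∧ X v w = c ∧ y v < s ∧ s < y w)
    {v : V} {c : ℤ} (h1 : L v ≤ c) (h2 : c ≤ R v + 1) : F c (y v) = F (L v) (y v) := by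
  obtain ⟨n, rfl⟩ := Int.le.dest h1
  clear h1
  induction n with
  | zero => simp
  | succ n ih =>
    rw [← ih (by push_cast at h2; omega)]
    by_contra hne
    push_cast at hne h2
    rw [← add_assoc] at hne
    obtain ⟨v', w', e, hX, hv, hw⟩ := jump _ _ hne
    have := h.vertex_edge v v' w' e (by rintro rfl; omega) (by rintro rfl; omega)
      (by omega) (by omega)
    omega

/-- Minimum principle: at a topmost point where a negative minimum is attained, concavity forces the
point above to attain it as well. A point inside a vertex segment is first moved to the left end of
the segment, which is clear and where `F` has the same value. -/
theorem nonneg_of_concave (h : IsVisibilityRepresentation G y L R X) {F : ℤ → ℤ → ℝ} {B : ℤ}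
    (supp : ∀ c s, F c s ≠ 0 → |c| ≤ B ∧ |s| ≤ B)
    (conc : ∀ c s, IsClearAt y L R c s → F c (s + 1) + F c (s - 1) ≤ 2 * F c s)
    (jump : ∀ c s, F (c + 1) s ≠ F c s → ∃ v w, G.Adj v w ∧ X v w = c ∧ y v < s ∧ s < y w)
    (c s : ℤ) : 0 ≤ F c s := by
  by_contra! hneg
  set D : Finset (ℤ × ℤ) := Finset.Icc (-B) B ×ˢ Finset.Icc (-B) B with hD
  have hmem : ∀ c s, F c s ≠ 0 → (c, s) ∈ D := by
    intro c s hcs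
    have := supp c s hcs
    simp only [hD, Finset.mem_product, Finset.mem_Icc]
    exact ⟨abs_le.1 this.1, abs_le.1 this.2⟩
  obtain ⟨p, hpD, hp⟩ := D.exists_min_image (fun p => F p.1 p.2) ⟨_, hmem c s hneg.ne⟩
  have hp0 : F p.1 p.2 < 0 := (hp _ (hmem c s hneg.ne)).trans_lt hneg
  have hmin : ∀ c s, F p.1 p.2 ≤ F c s := by
    intro c s
    by_cases h0 : F c s = 0
    · rw [h0]; exact hp0.le
    · exact hp _ (hmem c s h0)
  obtain ⟨q, hqD, hq⟩ := (D.filter fun q => F q.1 q.2 = F p.1 p.2).exists_max_image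
    (fun q => q.2) ⟨p, Finset.mem_filter.2 ⟨hpD, rfl⟩⟩
  have hqF := (Finset.mem_filter.1 hqD).2
  obtain ⟨c', hc', hclear⟩ : ∃ c', F c' q.2 = F p.1 p.2 ∧ IsClearAt y L R c' q.2 := by
    by_cases hcl : IsClearAt y L R q.1 q.2
    · exact ⟨q.1, hqF, hcl⟩
    · simp only [IsClearAt, not_forall, not_lt] at hcl
      obtain ⟨v, hv, h1, h2⟩ := hcl
      refine ⟨L v, ?_, hv ▸ h.isClearAt_left v⟩
      rw [← hqF, ← hv]
      exact (h.apply_left_of_jump jump h1.le (by omega)).symm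
  have h1 := conc c' q.2 hclear
  have h2 := hmin c' (q.2 - 1)
  have h3 := hmin c' (q.2 + 1)
  have h4 : F c' (q.2 + 1) = F p.1 p.2 := by linarith
  have h5 := hq (c', q.2 + 1) (Finset.mem_filter.2
    ⟨hmem _ _ (by rw [h4]; exact hp0.ne), h4⟩)
  simp at h5

/-- The edge on the left boundary of the support has `F` positive just to its right in all its
interior rows. The next edge that cuts into this positive strip turns out to join the same two
vertices, but an edge has only one column. -/
theorem eq_zero_of_concave (h : IsVisibilityRepresentation G y L R X) {F : ℤ → ℤ → ℝ} {B : ℤ}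
    (supp : ∀ c s, F c s ≠ 0 → |c| ≤ B ∧ |s| ≤ B)
    (conc : ∀ c s, IsClearAt y L R c s → F c (s + 1) + F c (s - 1) ≤ 2 * F c s)
    (jump : ∀ c s, F (c + 1) s ≠ F c s → ∃ v w, G.Adj v w ∧ X v w = c ∧ y v < s ∧ s < y w)
    (c s : ℤ) : F c s = 0 := by
  have nonneg := h.nonneg_of_concave supp conc jump
  by_contra hcs
  -- the leftmost column on which `F` does not vanish lies immediately to the right of an edge
  obtain ⟨x, ⟨r, hr⟩, hx⟩ := Int.exists_least_of_bdd (P := fun c => ∃ s, F c s ≠ 0)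
    ⟨-B, fun c ⟨s, hs⟩ => (abs_le.1 (supp c s hs).1).1⟩ ⟨c, s, hcs⟩
  have hx0 : ∀ s, F (x - 1) s = 0 := by
    intro s
    by_contra hne
    have := hx (x - 1) ⟨s, hne⟩
    omega
  obtain ⟨v, w, e, hX, hv, hw⟩ := jump (x - 1) r (by rw [hx0, sub_add_cancel]; exact hr)
  have conc_right : ∀ {v w}, G.Adj v w → ∀ s, y v < s → s < y w →
      F (X v w + 1) (s + 1) + F (X v w + 1) (s - 1) ≤ 2 * F (X v w + 1) s :=
    fun e s h1 h2 => conc _ _ (h.isClearAt_edge e h1 h2).2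
  have hpos : ∀ s, y v < s → s < y w → F x s ≠ 0 := by
    intro s h1 h2 h0
    have hc := conc_right e
    rw [hX, sub_add_cancel] at hc
    exact hr (eq_zero_of_concave_of_nonneg (nonneg x) hc h1 h2 h0 r hv.le hw.le)
  -- the first column after it that has a zero between the end rows of this edge
  obtain ⟨z, ⟨hxz, r', hv', hw', hr'⟩, hz⟩ := Int.exists_least_of_bdd
    (P := fun z => x ≤ z ∧ ∃ s, y v < s ∧ s < y w ∧ F z s = 0) ⟨x, fun z hz => hz.1⟩
    ⟨max x (B + 1), le_max_left _ _, r, hv, hw, by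
      by_contra hne
      have := (abs_le.1 (supp _ _ hne).1).2
      have := le_max_right x (B + 1)
      omega⟩
  have strip : ∀ c, x ≤ c → c < z → ∀ s, y v < s → s < y w → F c s ≠ 0 := by
    intro c h1 h2 s h3 h4 h0
    have := hz c ⟨h1, s, h3, h4, h0⟩
    omega
  have hxz' : x < z := by
    rcases hxz.lt_or_eq with hlt | rfl
    · exact hlt
    · exact absurd hr' (hpos r' hv' hw')
  obtain ⟨v', w', e', hX', hv'', hw''⟩ := jump (z - 1) r' (by
    rw [sub_add_cancel, hr']
    exact (strip (z - 1) (by omega) (by omega) r' hv' hw').symm)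
  have hzero : ∀ s, y v' ≤ s → s ≤ y w' → F z s = 0 := by
    have hc := conc_right e'
    rw [hX', sub_add_cancel] at hc
    exact eq_zero_of_concave_of_nonneg (nonneg z) hc hv'' hw'' hr'
  have left_right : ∀ u, L u ≤ z - 1 → z - 1 ≤ R u → F (z - 1) (y u) = F z (y u) := by
    intro u h1 h2
    rw [h.apply_left_of_jump jump h1 (by omega),
      h.apply_left_of_jump jump (v := u) (c := z) (by omega) (by omega)]
  -- A tail strictly inside the strip would carry the zero of column `z` back to column `z - 1`,
  -- since `F` is constant along its segment. The same holds for the head.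
  have htail : y v' ≤ y v := by
    by_contra! hlt
    refine strip (z - 1) (by omega) (by omega) (y v') hlt (by omega) ?_
    rw [left_right v' (hX' ▸ h.left_le_tail _ _ e') (hX' ▸ h.tail_le_right _ _ e')]
    exact hzero _ le_rfl (by omega)
  have hhead : y w ≤ y w' := by
    by_contra! hlt
    refine strip (z - 1) (by omega) (by omega) (y w') (by omega) hlt ?_
    rw [left_right w' (hX' ▸ h.left_le_head _ _ e') (hX' ▸ h.head_le_right _ _ e')]
    exact hzero _ (by omega) le_rfl
  -- an endpoint of the first edge reaches as far as the second edge
  have reach : ∀ u, L u ≤ x - 1 → x - 1 ≤ R u →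
      (∀ c, F c (y u + 1) + F c (y u - 1) ≤ 0 → ∃ s, y v < s ∧ s < y w ∧ F c s = 0) →
      z - 1 ≤ R u := by
    intro u h1 h2 h3
    by_contra! hlt
    -- Just past its right end, `u` still has the value zero inherited from column `x - 1`.
    -- Concavity there makes the neighbouring rows vanish, and one of them lies in the strip.
    have h4 := conc (R u + 1) (y u) (h.isClearAt_right u)
    have h5 : F (R u + 1) (y u) = F (x - 1) (y u) := by
      rw [h.apply_left_of_jump jump (v := u) (c := R u + 1) (by omega) le_rfl,
        h.apply_left_of_jump jump (v := u) (c := x - 1) h1 (by omega)]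
    rw [h5, hx0, mul_zero] at h4
    obtain ⟨s, h6, h7, h8⟩ := h3 _ h4
    exact strip _ (by omega) (by omega) s h6 h7 h8
  have hLv := h.left_le_tail _ _ e
  have hRv := h.tail_le_right _ _ e
  have hLw := h.left_le_head _ _ e
  have hRw := h.head_le_right _ _ e
  rw [hX] at hLv hRv hLw hRw
  have hvz : z - 1 ≤ R v := reach v hLv hRv fun c hc =>
    ⟨y v + 1, by omega, by omega, by linarith [nonneg c (y v + 1), nonneg c (y v - 1)]⟩
  have hwz : z - 1 ≤ R w := reach w hLw hRw fun c hc =>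
    ⟨y w - 1, by omega, by omega, by linarith [nonneg c (y w + 1), nonneg c (y w - 1)]⟩
  have hvv : v = v' := by
    by_contra hne
    have := h.vertex_edge v v' w' e' hne (by rintro rfl; omega) htail (by omega)
    omega
  have hww : w = w' := by
    by_contra hne
    have := h.vertex_edge w v' w' e' (by rintro rfl; omega) hne (by omega) hhead
    omega
  subst hvv hww
  omega

end IsVisibilityRepresentation

/-! ### Stresses and bending moments -/

/-- The positive part of `s - t`. -/
def ramp (t s : ℤ) : ℝ := max ((s : ℝ) - t) 0

theorem ramp_of_le {t s : ℤ} (h : s ≤ t) : ramp t s = 0 :=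
  max_eq_right (sub_nonpos.2 (Int.cast_le.2 h))

theorem ramp_of_ge {t s : ℤ} (h : t ≤ s) : ramp t s = s - t :=
  max_eq_left (sub_nonneg.2 (Int.cast_le.2 h))

/-- Ramps are Green functions of the second difference: moments are superpositions of ramps, one for
each force. -/
theorem ramp_second_difference (t s : ℤ) :
    ramp t (s + 1) + ramp t (s - 1) - 2 * ramp t s = if t = s then 1 else 0 := by
  rcases lt_trichotomy t s with h | rfl | h
  · rw [ramp_of_ge (by omega), ramp_of_ge (by omega), ramp_of_ge (by omega), if_neg (by omega)]
    push_cast; ring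
  · rw [ramp_of_ge (by omega), ramp_of_le (by omega), ramp_of_le (by omega), if_pos rfl]
    push_cast; ring
  · rw [ramp_of_le (by omega), ramp_of_le (by omega), ramp_of_le (by omega), if_neg (by omega)]
    ring

section Items

variable {V : Type*}

open Classical in
/-- The items of a drawing are the vertices `v`, encoded as `(v, v)`, and the edges. This is the
left end of an item in a visibility representation. -/
noncomputable def itemLeft (L : V → ℤ) (X : V → V → ℤ) (i : V × V) : ℤ :=
  if i.1 = i.2 then L i.1 else X i.1 i.2

/-- Vertices, encoded as `(v, v)`, and edges. -/
def IsItem (G : Digraph V) (i : V × V) : Prop :=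
  i.1 = i.2 ∨ G.Adj i.1 i.2

/-- The item `k.1` meets the row of the vertex `k.2`, which is not one of its endpoints. -/
structure IsAlongside (G : Digraph V) (y : V → ℤ) (k : (V × V) × V) : Prop where
  isItem : IsItem G k.1
  ne_fst : k.2 ≠ k.1.1
  ne_snd : k.2 ≠ k.1.2
  fst_le : y k.1.1 ≤ y k.2
  le_snd : y k.2 ≤ y k.1.2

/-- The point of the straight segment from `i.1` to `i.2` in row `r` divides it in this ratio. -/
noncomputable def itemWeight (y : V → ℤ) (i : V × V) (r : ℤ) : ℝ :=
  ((r : ℝ) - y i.1) / (y i.2 - y i.1)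

theorem itemWeight_mul {y : V → ℤ} {i : V × V} {r : ℤ} (h1 : y i.1 ≤ r) (h2 : r ≤ y i.2) :
    itemWeight y i r * (y i.2 - y i.1) = r - y i.1 := by
  by_cases h : y i.2 = y i.1
  · have : r = y i.1 := by omega
    -- For an item without extent, division by zero gives weight zero, and both sides vanish.
    simp [h, this]
  · rw [itemWeight, div_mul_cancel₀]
    rw [sub_ne_zero]
    exact_mod_cast h

/-- The bending moment of the beam `k.1` under a unit load in the row of `k.2`. -/
noncomputable def beamMoment (y : V → ℤ) (k : (V × V) × V) (s : ℤ) : ℝ :=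
  ramp (y k.2) s - (1 - itemWeight y k.1 (y k.2)) * ramp (y k.1.1) s
    - itemWeight y k.1 (y k.2) * ramp (y k.1.2) s

theorem beamMoment_of_le {y : V → ℤ} {k : (V × V) × V} {s : ℤ} (h1 : y k.1.1 ≤ y k.2)
    (h2 : y k.2 ≤ y k.1.2) (hs : s ≤ y k.1.1) : beamMoment y k s = 0 := by
  rw [beamMoment, ramp_of_le (by omega), ramp_of_le (by omega), ramp_of_le (by omega)]
  ring

/-- Beyond the top, forces and torques balance: the reactions at the ends add up to the unit load
and have its lever arm. -/
theorem beamMoment_of_ge {y : V → ℤ} {k : (V × V) × V} {s : ℤ} (h1 : y k.1.1 ≤ y k.2)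
    (h2 : y k.2 ≤ y k.1.2) (hs : y k.1.2 ≤ s) : beamMoment y k s = 0 := by
  rw [beamMoment, ramp_of_ge (by omega), ramp_of_ge (by omega), ramp_of_ge (by omega)]
  linear_combination itemWeight_mul h1 h2

variable [Fintype V]

open Classical in
/-- The displacement of the vertex `k.2` from the straight segment of the item `k.1`, as a linear
functional of the `x`-coordinates. -/
noncomputable def displacement (y : V → ℤ) (k : (V × V) × V) (v : V) : ℝ :=
  (if v = k.2 then 1 else 0) - (1 - itemWeight y k.1 (y k.2)) * (if v = k.1.1 then 1 else 0)
    - itemWeight y k.1 (y k.2) * (if v = k.1.2 then 1 else 0)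

open Classical in
theorem sum_displacement_mul (y : V → ℤ) (k : (V × V) × V) (x : V → ℝ) :
    ∑ v, displacement y k v * x v = x k.2 - (1 - itemWeight y k.1 (y k.2)) * x k.1.1
      - itemWeight y k.1 (y k.2) * x k.1.2 := by
  simp only [displacement]
  have single : ∀ (a : V) (f : V → ℝ), ∑ v, (if v = a then f v else 0) = f a := fun a f => by
    rw [Finset.sum_eq_single a (fun v _ hv => if_neg hv) (fun ha => (ha (Finset.mem_univ a)).elim),
      if_pos rfl]
  generalize itemWeight y k.1 (y k.2) = μ
  generalize 1 - μ = ν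
  simp only [sub_mul, Finset.sum_sub_distrib, mul_assoc, ite_mul, one_mul, zero_mul,
    ← Finset.mul_sum, single]

/-- The moments of the beams that lie to the left of the column `c`. -/
noncomputable def stressFunction (y R : V → ℤ) (X : V → V → ℤ) (g : (V × V) × V → ℝ)
    (c s : ℤ) : ℝ :=
  -- The argument `c` stands for the gap between the columns `c - 1` and `c`. The sign makes the
  -- function concave rather than convex.
  -∑ k, g k * if itemLeft R X k.1 < c then beamMoment y k s else 0

end Items

namespace IsVisibilityRepresentation

variable {V : Type*} {G : Digraph V} {y L R : V → ℤ} {X : V → V → ℤ}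

/-- No vertex segment of row `s` straddles a clear gap, so an endpoint in that row is on the same
side as its edge. -/
theorem right_lt_iff (h : IsVisibilityRepresentation G y L R X) {i : V × V} (hi : IsItem G i)
    {c s : ℤ} (hc : IsClearAt y L R c s) :
    (y i.1 = s → (R i.1 < c ↔ itemLeft R X i < c)) ∧
      (y i.2 = s → (R i.2 < c ↔ itemLeft R X i < c)) := by
  unfold itemLeft
  split_ifs with heq
  · rw [heq]; simp
  · have e := hi.resolve_left heq
    have h1 := h.left_le_tail _ _ e
    have h2 := h.tail_le_right _ _ e
    have h3 := h.left_le_head _ _ e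
    have h4 := h.head_le_right _ _ e
    refine ⟨fun hs => ?_, fun hs => ?_⟩
    · have := hc _ hs
      omega
    · have := hc _ hs
      omega

theorem itemLeft_le (h : IsVisibilityRepresentation G y L R X) (i : V × V) :
    itemLeft L X i ≤ itemLeft R X i := by
  unfold itemLeft
  split_ifs
  · exact h.le _
  · exact le_rfl

theorem alongside (h : IsVisibilityRepresentation G y L R X) {k : (V × V) × V}
    (hk : IsAlongside G y k) : itemLeft R X k.1 < L k.2 ∨ R k.2 < itemLeft L X k.1 := by
  unfold itemLeft
  split_ifs with heq
  · have := hk.fst_le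
    have := hk.le_snd
    rw [← heq] at this
    exact h.vertex_vertex _ _ hk.ne_fst.symm (by omega)
  · exact h.vertex_edge _ _ _ (hk.isItem.resolve_left heq) hk.ne_fst hk.ne_snd hk.fst_le hk.le_snd

variable [Fintype V] {g : (V × V) × V → ℝ}

open Classical in
-- Test the equilibrium against the indicator of the vertices of row `s` to the left of the gap. A
-- beam and its ends in this row are on the same side, so the reactions cancel. Only loads between a
-- vertex and an item on different sides of the gap remain.
theorem stressFunction_second_difference (h : IsVisibilityRepresentation G y L R X)
    (hg : ∀ k, g k ≠ 0 → IsAlongside G y k) (heq : ∀ v, ∑ k, g k * displacement y k v = 0)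
    {c s : ℤ} (hc : IsClearAt y L R c s) :
    stressFunction y R X g c (s + 1) + stressFunction y R X g c (s - 1)
      - 2 * stressFunction y R X g c s =
    ∑ k, g k * if y k.2 = s then
      (if R k.2 < c then 1 else 0) - (if itemLeft R X k.1 < c then 1 else 0) else 0 := by
  set t : V → ℝ := fun v => if y v = s then if R v < c then 1 else 0 else 0 with ht
  have h0 : ∑ k, g k * (∑ v, displacement y k v * t v) = 0 := by
    simp only [Finset.mul_sum]
    rw [Finset.sum_comm]
    refine Finset.sum_eq_zero fun v _ => ?_
    simp only [← mul_assoc]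
    rw [← Finset.sum_mul, heq, zero_mul]
  refine (add_zero _).symm.trans ?_
  conv_lhs => rw [← h0]
  simp only [stressFunction, sum_displacement_mul]
  rw [mul_neg, ← neg_add, sub_neg_eq_add, neg_add_eq_sub, Finset.mul_sum,
    ← Finset.sum_add_distrib, ← Finset.sum_sub_distrib, ← Finset.sum_add_distrib]
  refine Finset.sum_congr rfl fun k _ => ?_
  by_cases hk : g k = 0
  · simp [hk]
  obtain ⟨h1, h2⟩ := h.right_lt_iff (hg k hk).isItem hc
  have e0 := ramp_second_difference (y k.2) s
  have e1 := ramp_second_difference (y k.1.1) s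
  have e2 := ramp_second_difference (y k.1.2) s
  have t1 : t k.1.1 = if itemLeft R X k.1 < c then (if y k.1.1 = s then 1 else 0) else 0 := by
    by_cases hs : y k.1.1 = s
    · simp only [ht, hs, if_true, h1 hs]
    · simp [ht, hs]
  have t2 : t k.1.2 = if itemLeft R X k.1 < c then (if y k.1.2 = s then 1 else 0) else 0 := by
    by_cases hs : y k.1.2 = s
    · simp only [ht, hs, if_true, h2 hs]
    · simp [ht, hs]
  rw [t1, t2]
  have t0 : (if y k.2 = s then
      (if R k.2 < c then 1 else 0) - (if itemLeft R X k.1 < c then 1 else 0) else 0 : ℝ) =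
      t k.2 - if itemLeft R X k.1 < c then (if y k.2 = s then 1 else 0) else 0 := by
    simp only [ht]
    split_ifs <;> simp
  rw [t0]
  by_cases hl : itemLeft R X k.1 < c
  · simp only [hl, if_true, ← e0, ← e1, ← e2, beamMoment]
    ring
  · simp only [hl, if_false]
    ring

/-- The moment of a beam vanishes outside its open interval of rows, so passing column `c` is felt
only in the interior rows of edges standing there. -/
theorem stressFunction_jump (hg : ∀ k, g k ≠ 0 → IsAlongside G y k) (c s : ℤ)
    (hcs : stressFunction y R X g (c + 1) s ≠ stressFunction y R X g c s) :
    ∃ v w, G.Adj v w ∧ X v w = c ∧ y v < s ∧ s < y w := by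
  by_contra! hno
  refine hcs ?_
  simp only [stressFunction]
  congr 1
  refine Finset.sum_congr rfl fun k _ => ?_
  by_cases hk : g k = 0
  · simp [hk]
  have ha := hg k hk
  by_cases hm : beamMoment y k s = 0
  · simp [hm]
  have h1 : y k.1.1 < s := by
    by_contra! hle
    exact hm (beamMoment_of_le ha.fst_le ha.le_snd hle)
  have h2 : s < y k.1.2 := by
    by_contra! hle
    exact hm (beamMoment_of_ge ha.fst_le ha.le_snd hle)
  have hne : k.1.1 ≠ k.1.2 := by
    intro heq
    rw [heq] at h1
    omega
  have hX : itemLeft R X k.1 ≠ c := by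
    intro hX
    rw [itemLeft, if_neg hne] at hX
    exact absurd h2 (not_lt.2 (hno _ _ (ha.isItem.resolve_left hne) hX h1))
  have : itemLeft R X k.1 < c + 1 ↔ itemLeft R X k.1 < c := by omega
  simp only [this]

theorem stressFunction_support (h : IsVisibilityRepresentation G y L R X)
    (hg : ∀ k, g k ≠ 0 → IsAlongside G y k) (heq : ∀ v, ∑ k, g k * displacement y k v = 0) :
    ∃ B : ℤ, ∀ c s, stressFunction y R X g c s ≠ 0 → |c| ≤ B ∧ |s| ≤ B := by
  obtain ⟨B₁, hB₁⟩ := (Set.finite_range fun i => |itemLeft R X i|).bddAbove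
  obtain ⟨B₂, hB₂⟩ := (Set.finite_range fun v => |R v|).bddAbove
  obtain ⟨B₃, hB₃⟩ := (Set.finite_range fun v => |y v|).bddAbove
  have b1 : ∀ i, -B₁ ≤ itemLeft R X i ∧ itemLeft R X i ≤ B₁ := fun i => abs_le.1 (hB₁ ⟨i, rfl⟩)
  have b2 : ∀ v, -B₂ ≤ R v ∧ R v ≤ B₂ := fun v => abs_le.1 (hB₂ ⟨v, rfl⟩)
  have b3 : ∀ v, -B₃ ≤ y v ∧ y v ≤ B₃ := fun v => abs_le.1 (hB₃ ⟨v, rfl⟩)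
  have hlow : ∀ c s, s ≤ -B₃ → stressFunction y R X g c s = 0 := by
    intro c s hs
    rw [stressFunction, neg_eq_zero]
    refine Finset.sum_eq_zero fun k _ => ?_
    by_cases hk : g k = 0
    · simp [hk]
    · have ha := hg k hk
      have := b3 k.1.1
      simp [beamMoment_of_le ha.fst_le ha.le_snd (by omega : s ≤ y k.1.1)]
  have hhigh : ∀ c s, B₃ ≤ s → stressFunction y R X g c s = 0 := by
    intro c s hs
    rw [stressFunction, neg_eq_zero]
    refine Finset.sum_eq_zero fun k _ => ?_
    by_cases hk : g k = 0
    · simp [hk]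
    · have ha := hg k hk
      have := b3 k.1.2
      simp [beamMoment_of_ge ha.fst_le ha.le_snd (by omega : y k.1.2 ≤ s)]
  have hleft : ∀ c s, c ≤ -B₁ → stressFunction y R X g c s = 0 := by
    intro c s hs
    rw [stressFunction, neg_eq_zero]
    refine Finset.sum_eq_zero fun k _ => ?_
    have := b1 k.1
    rw [if_neg (by omega), mul_zero]
  -- To the right of everything no load crosses the gap, so the second differences vanish, and zeros
  -- in the low rows propagate upwards. In the other three directions the sum vanishes term by term.
  have hright : ∀ c s, B₁ < c → B₂ < c → stressFunction y R X g c s = 0 := by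
    intro c s hc1 hc2
    have hstep : ∀ s, stressFunction y R X g c (s + 1) =
        2 * stressFunction y R X g c s - stressFunction y R X g c (s - 1) := by
      intro s
      have hcl : IsClearAt y L R c s := fun v _ _ => (b2 v).2.trans_lt hc2
      have h1 := h.stressFunction_second_difference hg heq hcl
      rw [Finset.sum_eq_zero] at h1
      · linarith
      · intro k _
        have := (b1 k.1).2.trans_lt hc1
        have := (b2 k.2).2.trans_lt hc2
        simp [*]
    have hup : ∀ n : ℕ, stressFunction y R X g c (-B₃ + n) = 0 ∧
        stressFunction y R X g c (-B₃ + n - 1) = 0 := by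
      intro n
      induction n with
      | zero => exact ⟨hlow _ _ (by simp), hlow _ _ (by simp)⟩
      | succ n ih =>
        push_cast
        rw [← add_assoc, add_sub_cancel_right, hstep, ih.1, ih.2]
        simp
    rcases le_total s (-B₃) with hs | hs
    · exact hlow _ _ hs
    · obtain ⟨n, rfl⟩ := Int.le.dest hs
      exact (hup n).1
  refine ⟨max (max |B₁| |B₂|) |B₃| + 1, fun c s hcs => ?_⟩
  have m1 := le_abs_self B₁
  have m2 := le_abs_self B₂
  have m3 := le_abs_self B₃
  have m4 : -B₁ < c := by by_contra! hle; exact hcs (hleft _ _ hle)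
  have m5 : -B₃ < s := by by_contra! hle; exact hcs (hlow _ _ hle)
  have m6 : s < B₃ := by by_contra! hle; exact hcs (hhigh _ _ hle)
  have m7 : c ≤ B₁ ∨ c ≤ B₂ := by
    by_contra! hlt
    exact hcs (hright _ _ hlt.1 hlt.2)
  rw [abs_le, abs_le]
  omega

/-- A visibility representation admits no nonzero stress. -/
theorem stress_eq_zero (h : IsVisibilityRepresentation G y L R X)
    (hg : ∀ k, g k ≠ 0 → IsAlongside G y k) (heq : ∀ v, ∑ k, g k * displacement y k v = 0)
    (hpos : ∀ k, itemLeft R X k.1 < L k.2 → 0 ≤ g k)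
    (hneg : ∀ k, R k.2 < itemLeft L X k.1 → g k ≤ 0) (k : (V × V) × V) : g k = 0 := by
  classical
  obtain ⟨B, hB⟩ := h.stressFunction_support hg heq
  -- If the item is left of the vertex, `g k` is nonnegative and the gap passes the item first;
  -- otherwise both signs are reversed.
  have term : ∀ c s k, (g k * if y k.2 = s then
      (if R k.2 < c then 1 else 0) - (if itemLeft R X k.1 < c then 1 else 0) else 0) ≤ 0 := by
    intro c s k
    by_cases hk : g k = 0
    · simp [hk]
    have := h.le k.2
    have := h.itemLeft_le k.1
    rcases h.alongside (hg k hk) with hl | hl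
    · refine mul_nonpos_of_nonneg_of_nonpos (hpos k hl) ?_
      split_ifs <;> first | omega | simp
    · refine mul_nonpos_of_nonpos_of_nonneg (hneg k hl) ?_
      split_ifs <;> first | omega | simp
  have hF := h.eq_zero_of_concave hB (fun c s hc => by
    have h1 := h.stressFunction_second_difference hg heq hc
    have h2 := Finset.sum_nonpos fun k (_ : k ∈ Finset.univ) => term c s k
    linarith) (stressFunction_jump hg)
  have hzero : ∀ {c s}, IsClearAt y L R c s → ∀ k, (g k * if y k.2 = s then
      (if R k.2 < c then 1 else 0) - (if itemLeft R X k.1 < c then 1 else 0) else 0) = 0 := by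
    intro c s hc k
    have h1 := h.stressFunction_second_difference hg heq hc
    simp only [hF, mul_zero, add_zero, sub_zero] at h1
    exact (Finset.sum_eq_zero_iff_of_nonpos fun k _ => term c s k).1 h1.symm k (Finset.mem_univ k)
  by_contra hk
  have := h.le k.2
  have := h.itemLeft_le k.1
  rcases h.alongside (hg k hk) with hl | hl
  -- The gap just before the vertex separates it from an item on its left, so the summand there is
  -- `-g k`. For an item on the right, the gap just after the vertex serves instead.
  · have h1 := hzero (h.isClearAt_left k.2) k
    rw [if_pos rfl, if_neg (by omega), if_pos hl] at h1
    exact hk (by linarith)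
  · have h1 := hzero (h.isClearAt_right k.2) k
    rw [if_pos rfl, if_pos (by omega), if_neg (by omega)] at h1
    exact hk (by linarith)

open Classical in
/-- The `x`-coordinates of a straight-line drawing with the order of a visibility
representation. -/
theorem exists_coordinates (h : IsVisibilityRepresentation G y L R X) :
    ∃ x : V → ℤ, ∀ k, IsAlongside G y k →
      (itemLeft R X k.1 < L k.2 → 0 < ∑ v, displacement y k v * x v) ∧
      (R k.2 < itemLeft L X k.1 → ∑ v, displacement y k v * x v < 0) := by
  set σ : (V × V) × V → ℝ := fun k => if itemLeft R X k.1 < L k.2 then 1 else -1 with hσ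
  have hσ' : ∀ k, R k.2 < itemLeft L X k.1 → σ k = -1 := by
    intro k hk
    have := h.le k.2
    have := h.itemLeft_le k.1
    exact if_neg (by omega)
  rcases exists_forall_pos_or_exists_convex_combination_eq_zero
    (fun (k : {k // IsAlongside G y k}) v => σ k * displacement y k v) with
    ⟨x, hx⟩ | ⟨f, hf0, hf1, hf⟩
  · obtain ⟨z, hz⟩ := exists_int_forall_pos _ x hx
    refine ⟨z, fun k hk => ?_⟩
    have h1 := hz ⟨k, hk⟩
    simp only [mul_assoc, ← Finset.mul_sum] at h1
    refine ⟨fun hl => ?_, fun hl => ?_⟩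
    · simpa [hσ, hl] using h1
    · rw [hσ' k hl] at h1
      linarith
  -- With the signs absorbed, the coefficients form a stress. It has to vanish, although the
  -- coefficients sum to one.
  · exfalso
    have h0 := h.stress_eq_zero
      (g := fun k => if hk : IsAlongside G y k then f ⟨k, hk⟩ * σ k else 0) (fun k hk => by
        by_contra hno
        exact hk (dif_neg hno)) (fun v => by
        refine Eq.trans ?_ (hf v)
        simp only [dite_mul, zero_mul, mul_assoc]
        rw [Finset.sum_dite, Finset.sum_const_zero, add_zero]
        refine Finset.sum_bij (fun k _ => ⟨k.1, (Finset.mem_filter.1 k.2).2⟩) ?_ ?_ ?_ ?_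
        · simp
        · intro a _ b _ hab
          exact Subtype.ext (Subtype.mk.inj hab)
        · intro b _
          exact ⟨⟨b.1, Finset.mem_filter.2 ⟨Finset.mem_univ _, b.2⟩⟩, Finset.mem_attach _ _, rfl⟩
        · intro a _
          rfl) (fun k hl => by
        split_ifs with hk
        · rw [hσ]; simp [hl, hf0]
        · exact le_rfl) (fun k hl => by
        split_ifs with hk
        · rw [hσ' k hl]; simp [hf0]
        · exact le_rfl)
    have : ∀ k, f k = 0 := by
      intro k
      have h1 := h0 k.1
      rw [dif_pos k.2] at h1
      refine (mul_eq_zero.1 h1).resolve_right ?_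
      simp only [hσ]
      split_ifs <;> norm_num
    simp [this] at hf1

end IsVisibilityRepresentation

/-! ### From visibility representations to straight-line drawings -/

section Segments

variable {V : Type*} {pos : V → ℤ × ℤ} {v w : V} {p : ℝ × ℝ}

theorem mem_edgeSegment_iff (h : (pos v).2 < (pos w).2) :
    p ∈ edgeSegment pos v w ↔ ((pos v).2 : ℝ) ≤ p.2 ∧ p.2 ≤ (pos w).2 ∧
      p.1 * ((pos w).2 - (pos v).2) =
        (pos v).1 * ((pos w).2 - p.2) + (pos w).1 * (p.2 - (pos v).2) := by
  have h' : ((pos v).2 : ℝ) < (pos w).2 := by exact_mod_cast h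
  have hD : (0 : ℝ) < (pos w).2 - (pos v).2 := sub_pos.2 h'
  constructor
  · rintro ⟨a, b, ha, hb, hab, rfl⟩
    obtain rfl : a = 1 - b := by linarith
    simp only [toPlane, Prod.fst_add, Prod.snd_add, Prod.smul_fst, Prod.smul_snd, smul_eq_mul]
    refine ⟨?_, ?_, by ring⟩
    · nlinarith
    · nlinarith
  · rintro ⟨h1, h2, h3⟩
    refine ⟨((pos w).2 - p.2) / ((pos w).2 - (pos v).2),
      (p.2 - (pos v).2) / ((pos w).2 - (pos v).2), div_nonneg (by linarith) hD.le,
      div_nonneg (by linarith) hD.le, ?_, ?_⟩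
    · field_simp; ring
    · ext
      · simp only [toPlane, Prod.fst_add, Prod.smul_fst, smul_eq_mul]
        rw [div_mul_eq_mul_div, div_mul_eq_mul_div, ← add_div, div_eq_iff hD.ne', h3]
        ring
      · simp only [toPlane, Prod.snd_add, Prod.smul_snd, smul_eq_mul]
        rw [div_mul_eq_mul_div, div_mul_eq_mul_div, ← add_div, div_eq_iff hD.ne']
        ring

theorem eq_toPlane_left (h : (pos v).2 < (pos w).2) (hp : p ∈ edgeSegment pos v w)
    (hv : p.2 ≤ (pos v).2) : p = toPlane (pos v) := by
  obtain ⟨h1, h2, h3⟩ := (mem_edgeSegment_iff h).1 hp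
  have h' : ((pos v).2 : ℝ) < (pos w).2 := by exact_mod_cast h
  have h4 : p.2 = (pos v).2 := le_antisymm hv h1
  rw [h4, sub_self, mul_zero, add_zero] at h3
  exact Prod.ext (mul_right_cancel₀ (sub_pos.2 h').ne' h3) h4

theorem eq_toPlane_right (h : (pos v).2 < (pos w).2) (hp : p ∈ edgeSegment pos v w)
    (hw : (pos w).2 ≤ p.2) : p = toPlane (pos w) := by
  obtain ⟨h1, h2, h3⟩ := (mem_edgeSegment_iff h).1 hp
  have h' : ((pos v).2 : ℝ) < (pos w).2 := by exact_mod_cast h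
  have h4 : p.2 = (pos w).2 := le_antisymm h2 hw
  rw [h4, sub_self, mul_zero, zero_add] at h3
  exact Prod.ext (mul_right_cancel₀ (sub_pos.2 h').ne' h3) h4

end Segments

namespace IsVisibilityRepresentation

variable {V : Type*} {G : Digraph V} {L R : V → ℤ} {X : V → V → ℤ} {pos : V → ℤ × ℤ}

/-- Two edges in different columns cross nowhere if the vertices between the end rows of each lie
on the right side of it. -/
theorem exists_common_endpoint (h : IsVisibilityRepresentation G (fun v => (pos v).2) L R X)
    (left : ∀ u v w, G.Adj v w → u ≠ v → u ≠ w → (pos v).2 ≤ (pos u).2 →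
      (pos u).2 ≤ (pos w).2 → X v w < L u →
      ((pos v).1 : ℝ) * ((pos w).2 - (pos u).2) + (pos w).1 * ((pos u).2 - (pos v).2) <
        (pos u).1 * ((pos w).2 - (pos v).2))
    (right : ∀ u v w, G.Adj v w → u ≠ v → u ≠ w → (pos v).2 ≤ (pos u).2 →
      (pos u).2 ≤ (pos w).2 → R u < X v w →
      ((pos u).1 : ℝ) * ((pos w).2 - (pos v).2) <
        (pos v).1 * ((pos w).2 - (pos u).2) + (pos w).1 * ((pos u).2 - (pos v).2))
    {v w v' w' : V} (e : G.Adj v w) (e' : G.Adj v' w') (hX : X v w < X v' w') {p : ℝ × ℝ}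
    (hp : p ∈ edgeSegment pos v w) (hp' : p ∈ edgeSegment pos v' w') :
    ∃ u : V, (u = v ∨ u = w) ∧ (u = v' ∨ u = w') ∧ p = toPlane (pos u) := by
  have hy := h.upward _ _ e
  have hy' := h.upward _ _ e'
  have hyR : ((pos v).2 : ℝ) < (pos w).2 := by exact_mod_cast hy
  have hyR' : ((pos v').2 : ℝ) < (pos w').2 := by exact_mod_cast hy'
  obtain ⟨hp1, hp2, hp3⟩ := (mem_edgeSegment_iff hy).1 hp
  obtain ⟨hp1', hp2', hp3'⟩ := (mem_edgeSegment_iff hy').1 hp'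
  have r1 := h.left_le_tail _ _ e
  have r2 := h.left_le_head _ _ e
  have r1' := h.tail_le_right _ _ e'
  have r2' := h.head_le_right _ _ e'
  by_contra hno
  have hno' : ∀ u : V, (u = v ∨ u = w) → (u = v' ∨ u = w') → p ≠ toPlane (pos u) :=
    fun u h1 h2 h3 => hno ⟨u, h1, h2, h3⟩
  set D : ℝ := (pos w).2 - (pos v).2 with hD
  set D' : ℝ := (pos w').2 - (pos v').2 with hD'
  have hDpos : 0 < D := sub_pos.2 hyR
  have hDpos' : 0 < D' := sub_pos.2 hyR'
  -- `Q s` is `D * D'` times the signed horizontal distance from the first line to the second in row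
  -- `s`; it is affine and vanishes in the row of `p`.
  set Q : ℝ → ℝ := fun s => D * ((pos v').1 * ((pos w').2 - s) + (pos w').1 * (s - (pos v').2)) -
    D' * ((pos v).1 * ((pos w).2 - s) + (pos w).1 * (s - (pos v).2)) with hQ
  have hQp : Q p.2 = 0 := by
    simp only [hQ]
    rw [← hp3, ← hp3']
    ring
  have hQaff : ∀ s₀ s₁, Q p.2 * (s₁ - s₀) = Q s₀ * (s₁ - p.2) + Q s₁ * (p.2 - s₀) := by
    intro s₀ s₁
    simp only [hQ]
    ring
  have first : ∀ u, (u = v' ∨ u = w') → u ≠ v → u ≠ w → (pos v).2 ≤ (pos u).2 →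
      (pos u).2 ≤ (pos w).2 → 0 < Q (pos u).2 := by
    intro u hu huv huw h1 h2
    have h3 : X v w < L u := by
      refine (h.vertex_edge u v w e huv huw h1 h2).resolve_right ?_
      rcases hu with rfl | rfl <;> omega
    have h4 := left u v w e huv huw h1 h2 h3
    have h5 : ((pos v').1 : ℝ) * ((pos w').2 - (pos u).2) + (pos w').1 * ((pos u).2 - (pos v').2) =
        (pos u).1 * D' := by
      rcases hu with rfl | rfl <;> ring
    simp only [hQ]
    rw [h5]
    have := mul_pos hDpos' (sub_pos.2 h4)
    linarith
  have second : ∀ u, (u = v ∨ u = w) → u ≠ v' → u ≠ w' → (pos v').2 ≤ (pos u).2 →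
      (pos u).2 ≤ (pos w').2 → 0 < Q (pos u).2 := by
    intro u hu huv huw h1 h2
    have h3 : R u < X v' w' := by
      refine (h.vertex_edge u v' w' e' huv huw h1 h2).resolve_left ?_
      rcases hu with rfl | rfl <;> omega
    have h4 := right u v' w' e' huv huw h1 h2 h3
    have h5 : ((pos v).1 : ℝ) * ((pos w).2 - (pos u).2) + (pos w).1 * ((pos u).2 - (pos v).2) =
        (pos u).1 * D := by
      rcases hu with rfl | rfl <;> ring
    simp only [hQ]
    rw [h5]
    have := mul_pos hDpos (sub_pos.2 h4)
    linarith
  have hrow : ∀ {u u' : V}, ((pos u).2 : ℝ) ≤ p.2 → p.2 ≤ (pos u').2 → (pos u).2 ≤ (pos u').2 :=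
    fun h1 h2 => by exact_mod_cast h1.trans h2
  -- The higher of two different tails lies in the row range of both edges. Either it is a common
  -- endpoint equal to `p`, which is excluded, or the order of the columns makes `Q` positive there.
  have low : v = v' ∨ ∃ s₀ ≤ p.2, 0 < Q s₀ := by
    by_cases hvv : v = v'
    · exact Or.inl hvv
    refine Or.inr ?_
    rcases le_total (pos v).2 (pos v').2 with hle | hle
    · refine ⟨_, hp1', first v' (Or.inl rfl) (Ne.symm hvv) ?_ hle (hrow hp1' hp2)⟩
      rintro rfl
      exact hno' _ (Or.inr rfl) (Or.inl rfl) (eq_toPlane_right hy hp hp1')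
    · refine ⟨_, hp1, second v (Or.inl rfl) hvv ?_ hle (hrow hp1 hp2')⟩
      rintro rfl
      exact hno' _ (Or.inl rfl) (Or.inr rfl) (eq_toPlane_left hy hp hp2')
  have high : w = w' ∨ ∃ s₁ ≥ p.2, 0 < Q s₁ := by
    by_cases hww : w = w'
    · exact Or.inl hww
    refine Or.inr ?_
    rcases le_total (pos w).2 (pos w').2 with hle | hle
    · refine ⟨_, hp2, second w (Or.inr rfl) ?_ hww (hrow hp1' hp2) hle⟩
      rintro rfl
      exact hno' _ (Or.inr rfl) (Or.inl rfl) (eq_toPlane_right hy hp hp1')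
    · refine ⟨_, hp2', first w' (Or.inr rfl) ?_ (Ne.symm hww) (hrow hp1 hp2') hle⟩
      rintro rfl
      exact hno' _ (Or.inl rfl) (Or.inr rfl) (eq_toPlane_left hy hp hp2')
  have hne : ∀ {s}, 0 < Q s → s ≠ p.2 := by
    rintro s hs rfl
    exact hs.ne' hQp
  -- An affine function with a zero cannot be positive on both sides of it. If `Q` vanishes at a
  -- shared end and is positive at the other side, then `p` is that shared end.
  rcases low with hv | ⟨s₀, h0, hs₀⟩ <;> rcases high with hw | ⟨s₁, h1, hs₁⟩
  · subst hv hw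
    exact lt_irrefl _ hX
  · have h2 := hQaff (pos v).2 s₁
    have h3 : Q (pos v).2 = 0 := by
      subst hv
      simp only [hQ, hD, hD']
      ring
    rw [hQp, h3, zero_mul, zero_mul, zero_add] at h2
    have h4 := (mul_eq_zero.1 h2.symm).resolve_left hs₁.ne'
    exact hno' v (Or.inl rfl) (Or.inl hv) (eq_toPlane_left hy hp (by linarith))
  · have h2 := hQaff s₀ (pos w).2
    have h3 : Q (pos w).2 = 0 := by
      subst hw
      simp only [hQ, hD, hD']
      ring
    rw [hQp, h3, zero_mul, zero_mul, add_zero] at h2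
    have h4 := (mul_eq_zero.1 h2.symm).resolve_left hs₀.ne'
    exact hno' w (Or.inr rfl) (Or.inr hw) (eq_toPlane_right hy hp (by linarith))
  · have h2 := hQaff s₀ s₁
    rw [hQp, zero_mul] at h2
    have h3 := mul_pos hs₀ (sub_pos.2 (lt_of_le_of_ne h1 (hne hs₁).symm))
    have h4 := mul_pos hs₁ (sub_pos.2 (lt_of_le_of_ne h0 (hne hs₀)))
    linarith

/-- Edges of one column can only be stacked. If they meet, the higher tail has its segment across
the first edge and so is an endpoint of it; with equal tails, the lower head would block the other
edge. -/
theorem exists_common_endpoint_of_column_eq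
    (h : IsVisibilityRepresentation G (fun v => (pos v).2) L R X) {v w v' w' : V} (e : G.Adj v w)
    (e' : G.Adj v' w') (hne : (v, w) ≠ (v', w')) (hX : X v w = X v' w')
    (hle : (pos v).2 ≤ (pos v').2) {p : ℝ × ℝ}
    (hp : p ∈ edgeSegment pos v w) (hp' : p ∈ edgeSegment pos v' w') :
    ∃ u : V, (u = v ∨ u = w) ∧ (u = v' ∨ u = w') ∧ p = toPlane (pos u) := by
  have hy := h.upward _ _ e
  have hy' := h.upward _ _ e'
  obtain ⟨hp1, hp2, -⟩ := (mem_edgeSegment_iff hy).1 hp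
  obtain ⟨hp1', hp2', -⟩ := (mem_edgeSegment_iff hy').1 hp'
  have l1 := h.left_le_tail _ _ e'
  have r1 := h.tail_le_right _ _ e'
  have l2 := h.left_le_head _ _ e
  have r2 := h.head_le_right _ _ e
  have l2' := h.left_le_head _ _ e'
  have r2' := h.head_le_right _ _ e'
  by_cases hw : v' = w
  · exact ⟨w, Or.inr rfl, Or.inl hw.symm, eq_toPlane_right hy hp (hw ▸ hp1')⟩
  have hv : v' = v := by
    by_contra hv
    have hle' : ((pos v').2 : ℝ) ≤ (pos w).2 := hp1'.trans hp2
    have := h.vertex_edge v' v w e hv hw hle (by exact_mod_cast hle')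
    omega
  subst hv
  have hww : w ≠ w' := fun hww => hne (by rw [hww])
  exfalso
  rcases le_total (pos w).2 (pos w').2 with hl | hl
  · have := h.vertex_edge w v' w' e' (Ne.symm hw) hww hy.le hl
    omega
  · have := h.vertex_edge w' v' w e (by rintro rfl; exact lt_irrefl _ hy') hww.symm hy'.le hl
    omega

variable {y : V → ℤ}

theorem exists_isUpwardDrawing [Fintype V] (h : IsVisibilityRepresentation G y L R X) :
    ∃ pos : V → ℤ × ℤ, IsUpwardDrawing G pos ∧ (∀ v, (pos v).2 = y v) ∧
      ∀ u v, y u = y v → ((pos u).1 < (pos v).1 ↔ L u < L v) := by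
  obtain ⟨x, hx⟩ := h.exists_coordinates
  have row : ∀ u v, u ≠ v → y u = y v → R u < L v → x u < x v := by
    intro u v hne huv hlt
    have h1 := (hx ((u, u), v) ⟨Or.inl rfl, hne.symm, hne.symm, huv.le, huv.ge⟩).1
      (by simpa [itemLeft] using hlt)
    rw [sum_displacement_mul] at h1
    have h2 : (x u : ℝ) < x v := by linarith
    exact_mod_cast h2
  have edge : ∀ u v w, G.Adj v w → u ≠ v → u ≠ w → y v ≤ y u → y u ≤ y w →
      (X v w < L u → (x v : ℝ) * (y w - y u) + x w * (y u - y v) < x u * (y w - y v)) ∧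
      (R u < X v w → (x u : ℝ) * (y w - y v) < x v * (y w - y u) + x w * (y u - y v)) := by
    intro u v w e huv huw h1 h2
    have hne : v ≠ w := by
      rintro rfl
      exact lt_irrefl _ (h.upward _ _ e)
    have hD : (0 : ℝ) < y w - y v := sub_pos.2 (by exact_mod_cast h.upward _ _ e)
    have h3 := hx ((v, w), u) ⟨Or.inr e, huv, huw, h1, h2⟩
    have h4 := itemWeight_mul (i := (v, w)) h1 h2
    rw [sum_displacement_mul] at h3
    simp only [itemLeft, if_neg hne] at h3 h4
    generalize itemWeight y (v, w) (y u) = μ at h3 h4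
    have h5 : (x u - (1 - μ) * x v - μ * x w) * ((y w : ℝ) - y v) =
        x u * (y w - y v) - (x v * (y w - y u) + x w * (y u - y v)) := by
      linear_combination (x v - x w : ℝ) * h4
    refine ⟨fun hl => ?_, fun hl => ?_⟩
    · have := mul_pos (h3.1 hl) hD
      linarith
    · have := mul_neg_of_neg_of_pos (h3.2 hl) hD
      linarith
  have hinj : Function.Injective fun v => (x v, y v) := by
    intro u v huv
    by_contra hne
    obtain ⟨h1, h2⟩ := Prod.mk.inj huv
    rcases h.vertex_vertex u v hne h2 with hl | hl
    · exact (row u v hne h2 hl).ne h1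
    · exact (row v u (Ne.symm hne) h2.symm hl).ne' h1
  refine ⟨fun v => (x v, y v), ⟨⟨hinj, ?_, ?_⟩, h.upward⟩, fun _ => rfl, ?_⟩
  · intro u v w e huv huw hmem
    obtain ⟨h1, h2, h3⟩ := (mem_edgeSegment_iff (pos := fun v => (x v, y v)) (h.upward _ _ e)).1 hmem
    simp only [toPlane] at h1 h2 h3
    have h1' : y v ≤ y u := by exact_mod_cast h1
    have h2' : y u ≤ y w := by exact_mod_cast h2
    obtain ⟨h4, h5⟩ := edge u v w e huv huw h1' h2'
    rcases h.vertex_edge u v w e huv huw h1' h2' with hl | hl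
    · exact (h4 hl).ne' h3
    · exact (h5 hl).ne h3
  · rintro v w v' w' e e' hne p ⟨hp, hp'⟩
    have left := fun u v w e huv huw h1 h2 => (edge u v w e huv huw h1 h2).1
    have right := fun u v w e huv huw h1 h2 => (edge u v w e huv huw h1 h2).2
    rcases lt_trichotomy (X v w) (X v' w') with hlt | heq | hlt
    · exact exists_common_endpoint (pos := fun v => (x v, y v)) h left right e e' hlt hp hp'
    · rcases le_total (y v) (y v') with hle | hle
      · exact exists_common_endpoint_of_column_eq (pos := fun v => (x v, y v)) h e e' hne heq hle
          hp hp'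
      · obtain ⟨u, h1, h2, h3⟩ := exists_common_endpoint_of_column_eq
          (pos := fun v => (x v, y v)) h e' e hne.symm heq.symm hle hp' hp
        exact ⟨u, h2, h1, h3⟩
    · obtain ⟨u, h1, h2, h3⟩ :=
        exists_common_endpoint (pos := fun v => (x v, y v)) h left right e' e hlt hp' hp
      exact ⟨u, h2, h1, h3⟩
  · intro u v huv
    by_cases hne : u = v
    · simp [hne]
    have := h.le u
    have := h.le v
    rcases h.vertex_vertex u v hne huv with hl | hl
    · exact iff_of_true (row u v hne huv hl) (by omega)
    · exact iff_of_false (row v u (Ne.symm hne) huv.symm hl).not_gt (by omega)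

end IsVisibilityRepresentation

/-! ### From straight-line drawings to visibility representations -/

/-- A relation on a finite type for which all nonempty sets have minimal elements is increasing
under a numbering. -/
theorem exists_numbering {α : Type*} [Fintype α] (r : α → α → Prop)
    (hr : ∀ S : Finset α, S.Nonempty → ∃ s ∈ S, ∀ t ∈ S, ¬ r t s) :
    ∃ p : α → ℤ, (∀ a, 0 ≤ p a ∧ p a ≤ Fintype.card α) ∧ ∀ a b, r a b → p a < p b := by
  classical
  have hwf : WellFounded r := by
    rw [WellFounded.wellFounded_iff_has_min]
    intro s hs
    obtain ⟨m, hm, hmin⟩ := hr s.toFinset (by simpa using hs)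
    exact ⟨m, by simpa using hm, fun x hx => hmin x (by simpa using hx)⟩
  refine ⟨fun a => (Finset.univ.filter fun b => Relation.TransGen r b a).card,
    fun a => ⟨Nat.cast_nonneg _, Nat.cast_le.2 (Finset.card_le_univ _)⟩,
    fun a b hab => Nat.cast_lt.2 (Finset.card_lt_card ?_)⟩
  rw [Finset.ssubset_iff_of_subset]
  · refine ⟨a, by simpa using Relation.TransGen.single hab, ?_⟩
    simpa using hwf.transGen.irrefl.irrefl a
  · intro c hc
    simp only [Finset.mem_filter, Finset.mem_univ, true_and] at hc ⊢
    exact hc.tail hab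

section Drawing

variable {V : Type*} {G : Digraph V} {pos : V → ℤ × ℤ}

/-- The reciprocal slope of an edge (zero for vertices). -/
noncomputable def itemSlope (pos : V → ℤ × ℤ) (i : V × V) : ℝ :=
  ((pos i.2).1 - (pos i.1).1) / ((pos i.2).2 - (pos i.1).2)

/-- The `x`-coordinate of an item in the row `r`. -/
noncomputable def itemPoint (pos : V → ℤ × ℤ) (i : V × V) (r : ℝ) : ℝ :=
  (pos i.1).1 + (r - (pos i.1).2) * itemSlope pos i

/-- The item `i` meets the row `r`. -/
def MeetsRow (pos : V → ℤ × ℤ) (i : V × V) (r : ℝ) : Prop :=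
  ((pos i.1).2 : ℝ) ≤ r ∧ r ≤ (pos i.2).2

/-- In some row, the item `a` lies to the left of the item `b`. -/
def IsLeftOf (G : Digraph V) (pos : V → ℤ × ℤ) (a b : V × V) : Prop :=
  IsItem G a ∧ IsItem G b ∧
    ∃ r, MeetsRow pos a r ∧ MeetsRow pos b r ∧ itemPoint pos a r < itemPoint pos b r

theorem itemPoint_bottom (i : V × V) : itemPoint pos i (pos i.1).2 = (pos i.1).1 := by
  simp [itemPoint]

namespace IsUpwardDrawing

theorem bottom_le_top (h : IsUpwardDrawing G pos) {i : V × V} (hi : IsItem G i) :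
    (pos i.1).2 ≤ (pos i.2).2 := by
  rcases hi with hi | hi
  · rw [hi]
  · exact (h.upward _ _ hi).le

theorem itemPoint_top (h : IsUpwardDrawing G pos) {i : V × V} (hi : IsItem G i) :
    itemPoint pos i (pos i.2).2 = (pos i.2).1 := by
  rcases hi with hi | hi
  · simp [itemPoint, hi]
  · have : ((pos i.1).2 : ℝ) < (pos i.2).2 := by exact_mod_cast h.upward _ _ hi
    rw [itemPoint, itemSlope, mul_div_cancel₀ _ (sub_pos.2 this).ne']
    ring

theorem itemPoint_of_vertex {i : V × V} (hi : i.1 = i.2) {r : ℝ} (hr : MeetsRow pos i r) :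
    (itemPoint pos i r, r) = toPlane (pos i.1) := by
  have : r = (pos i.1).2 := le_antisymm (hi ▸ hr.2) hr.1
  rw [this, itemPoint_bottom, toPlane]

theorem itemPoint_mem_edgeSegment (h : IsUpwardDrawing G pos) {i : V × V}
    (hi : G.Adj i.1 i.2) {r : ℝ} (hr : MeetsRow pos i r) :
    (itemPoint pos i r, r) ∈ edgeSegment pos i.1 i.2 := by
  have : ((pos i.1).2 : ℝ) < (pos i.2).2 := by exact_mod_cast h.upward _ _ hi
  refine (mem_edgeSegment_iff (h.upward _ _ hi)).2 ⟨hr.1, hr.2, ?_⟩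
  have h1 := div_mul_cancel₀ (((pos i.2).1 : ℝ) - (pos i.1).1) (sub_pos.2 this).ne'
  simp only [itemPoint, itemSlope]
  linear_combination (r - (pos i.1).2) * h1

/-- Two items touch only in a common endpoint. -/
theorem exists_endpoint_of_itemPoint_eq (h : IsUpwardDrawing G pos) {a b : V × V}
    (ha : IsItem G a) (hb : IsItem G b) (hab : a ≠ b) {r : ℝ} (har : MeetsRow pos a r)
    (hbr : MeetsRow pos b r) (heq : itemPoint pos a r = itemPoint pos b r) :
    ∃ u, (u = a.1 ∨ u = a.2) ∧ (u = b.1 ∨ u = b.2) ∧ r = (pos u).2 := by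
  have key : ∀ {a b : V × V}, a.1 = a.2 → G.Adj b.1 b.2 → MeetsRow pos a r → MeetsRow pos b r →
      itemPoint pos a r = itemPoint pos b r →
      ∃ u, (u = a.1 ∨ u = a.2) ∧ (u = b.1 ∨ u = b.2) ∧ r = (pos u).2 := by
    intro a b ha hb har hbr heq
    have h1 := itemPoint_of_vertex ha har
    have h2 := h.itemPoint_mem_edgeSegment hb hbr
    rw [← heq, h1] at h2
    refine ⟨a.1, Or.inl rfl, ?_, (Prod.mk.inj h1).2⟩
    by_contra! hno
    exact h.planar.vertex_edge _ _ _ hb hno.1 hno.2 h2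
  by_cases ha' : a.1 = a.2
  · by_cases hb' : b.1 = b.2
    · exfalso
      have h1 := itemPoint_of_vertex ha' har
      have h2 := itemPoint_of_vertex hb' hbr
      rw [heq, h2] at h1
      obtain ⟨h3, h4⟩ := Prod.mk.inj h1
      have h5 : b.1 = a.1 := h.planar.vertex_vertex
        (Prod.ext (by exact_mod_cast h3) (by exact_mod_cast h4))
      exact hab (Prod.ext h5.symm (by rw [← ha', ← hb', h5]))
    · exact key ha' (hb.resolve_left hb') har hbr heq
  · have e := ha.resolve_left ha'
    rcases hb with hb | hb
    · obtain ⟨u, h1, h2, h3⟩ := key hb e hbr har heq.symm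
      exact ⟨u, h2, h1, h3⟩
    · obtain ⟨u, h1, h2, h3⟩ := h.planar.edge_edge _ _ _ _ e hb hab (itemPoint pos a r, r)
        ⟨h.itemPoint_mem_edgeSegment e har, heq ▸ h.itemPoint_mem_edgeSegment hb hbr⟩
      exact ⟨u, h1, h2, (Prod.mk.inj h3).2⟩

/-- Two items have the same order in all rows. -/
theorem itemPoint_le (h : IsUpwardDrawing G pos) {a b : V × V} (ha : IsItem G a)
    (hb : IsItem G b) {r r' : ℝ} (har : MeetsRow pos a r) (hbr : MeetsRow pos b r)
    (hlt : itemPoint pos a r < itemPoint pos b r) (har' : MeetsRow pos a r')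
    (hbr' : MeetsRow pos b r') : itemPoint pos a r' ≤ itemPoint pos b r' := by
  by_contra! hgt
  set d : ℝ → ℝ := fun t => itemPoint pos a t - itemPoint pos b t with hd
  have d1 : d r < 0 := sub_neg.2 hlt
  have d2 : 0 < d r' := sub_pos.2 hgt
  -- The affine difference `d` vanishes in a row `t` strictly between `r` and `r'`. The items touch
  -- there, but an endpoint is in an extreme row of its item, which meets both `r` and `r'`.
  set θ : ℝ := d r' / (d r' - d r) with hθ
  have hpos : 0 < d r' - d r := by linarith
  have hθ0 : 0 < θ := div_pos d2 hpos
  have hθ1 : θ < 1 := (div_lt_one hpos).2 (by linarith)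
  set t : ℝ := θ * r + (1 - θ) * r' with ht
  have hdt : d t = 0 := by
    have h1 : d t = d r' - θ * (d r' - d r) := by
      simp only [hd, ht, itemPoint]
      ring
    rw [h1, hθ, div_mul_cancel₀ _ hpos.ne', sub_self]
  have hne : a ≠ b := by
    rintro rfl
    exact lt_irrefl _ hlt
  have hmeet : ∀ {i : V × V}, MeetsRow pos i r → MeetsRow pos i r' → MeetsRow pos i t := by
    intro i h1 h2
    have := h1.1
    have := h1.2
    have := h2.1
    have := h2.2
    constructor <;> nlinarith
  obtain ⟨u, hu, -, hut⟩ := h.exists_endpoint_of_itemPoint_eq ha hb hne (hmeet har har')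
    (hmeet hbr hbr') (sub_eq_zero.1 hdt)
  have hrr : r ≠ r' := by
    rintro rfl
    linarith
  have h1 := har.1
  have h2 := har.2
  have h3 := har'.1
  have h4 := har'.2
  have tr : t - r = (1 - θ) * (r' - r) := by rw [ht]; ring
  have tr' : t - r' = -(θ * (r' - r)) := by rw [ht]; ring
  rcases lt_or_gt_of_ne hrr with hl | hl
  · have := mul_pos (sub_pos.2 hθ1) (sub_pos.2 hl)
    have := mul_pos hθ0 (sub_pos.2 hl)
    rcases hu with rfl | rfl <;> linarith
  · have := mul_neg_of_pos_of_neg (sub_pos.2 hθ1) (sub_neg.2 hl)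
    have := mul_neg_of_pos_of_neg hθ0 (sub_neg.2 hl)
    rcases hu with rfl | rfl <;> linarith

/-- Among finitely many items of an upward drawing, some can be moved to the left. -/
theorem exists_leftmost (h : IsUpwardDrawing G pos) (S : Finset (V × V)) (hS : S.Nonempty)
    (hSi : ∀ i ∈ S, IsItem G i) : ∃ s ∈ S, ∀ t ∈ S, ¬ IsLeftOf G pos t s := by
  classical
  -- items whose bottom is visible from the left
  set T := S.filter fun i => ∀ t ∈ S, MeetsRow pos t (pos i.1).2 →
    ((pos i.1).1 : ℝ) ≤ itemPoint pos t (pos i.1).2 with hT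
  have hTne : T.Nonempty := by
    obtain ⟨i, hi, hmin⟩ := S.exists_min_image (fun i => toLex ((pos i.1).2, (pos i.1).1)) hS
    refine ⟨i, Finset.mem_filter.2 ⟨hi, fun t ht hti => ?_⟩⟩
    have h1 := hmin t ht
    have h2 : (pos t.1).2 ≤ (pos i.1).2 := by exact_mod_cast hti.1
    rw [Prod.Lex.toLex_le_toLex] at h1
    obtain ⟨h3, h4⟩ := h1.resolve_left h2.not_gt
    simp only at h3 h4
    rw [h3, itemPoint_bottom]
    exact_mod_cast h4
  -- The candidate starts at the highest bottom visible from the left and leans furthest to the left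
  -- among the items of `T` in that row.
  obtain ⟨s₀, hs₀, hmax⟩ := T.exists_max_image (fun i => (pos i.1).2) hTne
  obtain ⟨s, hs, hmin⟩ := (T.filter fun i => (pos i.1).2 = (pos s₀.1).2).exists_min_image
    (itemSlope pos) ⟨s₀, Finset.mem_filter.2 ⟨hs₀, rfl⟩⟩
  obtain ⟨hsT, hss₀⟩ := Finset.mem_filter.1 hs
  obtain ⟨hsS, hvis⟩ := Finset.mem_filter.1 hsT
  -- An item left of `s` that starts no higher would, by visibility, touch `s` at its bottom. They
  -- would share this bottom, and the slope of `s` would not be minimal.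
  have higher : ∀ t ∈ S, IsLeftOf G pos t s → (pos s.1).2 < (pos t.1).2 := by
    rintro t ht ⟨hti, hsi, r, htr, hsr, hlt⟩
    by_contra! hle
    have hmt : MeetsRow pos t (pos s.1).2 := ⟨by exact_mod_cast hle, hsr.1.trans htr.2⟩
    have hms : MeetsRow pos s (pos s.1).2 := ⟨le_rfl, hsr.1.trans hsr.2⟩
    have h1 := hvis t ht hmt
    have h2 := h.itemPoint_le hti hsi htr hsr hlt hmt hms
    rw [itemPoint_bottom] at h2
    have h3 : itemPoint pos t (pos s.1).2 = itemPoint pos s (pos s.1).2 := by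
      rw [itemPoint_bottom]; exact le_antisymm h2 h1
    have hts : t ≠ s := by
      rintro rfl
      exact lt_irrefl _ hlt
    obtain ⟨u, hut, hus, hu⟩ := h.exists_endpoint_of_itemPoint_eq hti hsi hts hmt hms h3
    have hr : ((pos s.1).2 : ℝ) < r := by
      refine lt_of_le_of_ne hsr.1 ?_
      rintro rfl
      exact hlt.ne h3
    have hut' : u = t.1 := hut.resolve_right (by
      rintro rfl
      have := htr.2
      linarith)
    have hus' : u = s.1 := hus.resolve_right (by
      rintro rfl
      have := hsr.2
      linarith)
    have hst : t.1 = s.1 := hut'.symm.trans hus'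
    have h4 := hmin t (Finset.mem_filter.2 ⟨Finset.mem_filter.2 ⟨ht, by rwa [hst]⟩, by
      rw [hst, hss₀]⟩)
    have h5 := mul_le_mul_of_nonneg_left h4 (sub_pos.2 hr).le
    rw [itemPoint, itemPoint, hst] at hlt
    linarith
  refine ⟨s, hsS, fun t₀ ht₀ hts₀ => ?_⟩
  -- The lowest, then leftmost, item `t` left of `s` starts above all of `T`, so its bottom is
  -- hidden behind some `t'`. This item is also left of `s` and contradicts the choice of `t`.
  obtain ⟨t, ht, htmin⟩ := (S.filter fun t => IsLeftOf G pos t s).exists_min_image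
    (fun i => toLex ((pos i.1).2, (pos i.1).1)) ⟨t₀, Finset.mem_filter.2 ⟨ht₀, hts₀⟩⟩
  obtain ⟨htS, hts⟩ := Finset.mem_filter.1 ht
  have hst := higher t htS hts
  have hnot : t ∉ T := fun htT => by
    have := hmax t htT
    omega
  obtain ⟨hti, hsi, r, htr, hsr, hlt⟩ := hts
  have : ∃ t' ∈ S, MeetsRow pos t' (pos t.1).2 ∧
      itemPoint pos t' (pos t.1).2 < (pos t.1).1 := by
    by_contra! hno
    exact hnot (Finset.mem_filter.2 ⟨htS, hno⟩)
  obtain ⟨t', ht', hmt', hlt'⟩ := this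
  have hms : MeetsRow pos s (pos t.1).2 := ⟨by exact_mod_cast hst.le, htr.1.trans hsr.2⟩
  have h1 := h.itemPoint_le hti hsi htr hsr hlt ⟨le_rfl, htr.1.trans htr.2⟩ hms
  rw [itemPoint_bottom] at h1
  have h2 := htmin t' (Finset.mem_filter.2 ⟨ht', hSi t' ht', hsi, _, hmt', hms,
    hlt'.trans_le h1⟩)
  have h3 : (pos t'.1).2 ≤ (pos t.1).2 := by exact_mod_cast hmt'.1
  rw [Prod.Lex.toLex_le_toLex] at h2
  obtain ⟨h4, h5⟩ := h2.resolve_left h3.not_gt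
  simp only at h4 h5
  rw [h4, itemPoint_bottom] at hlt'
  have h6 : (pos t'.1).1 < (pos t.1).1 := by exact_mod_cast hlt'
  omega

/-- All items incident to a vertex pass through its point. What lies to the right of this point is
thus to the right of each of them, and so exceeds the largest of their numbers. -/
theorem exists_isVisibilityRepresentation [Fintype V] (h : IsUpwardDrawing G pos) :
    ∃ (L R : V → ℤ) (X : V → V → ℤ),
      IsVisibilityRepresentation G (fun v => (pos v).2) L R X ∧
      (∀ v, 0 ≤ L v ∧ R v ≤ (Fintype.card V : ℤ) ^ 2) ∧
      ∀ v w, 0 ≤ X v w ∧ X v w ≤ (Fintype.card V : ℤ) ^ 2 := by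
  classical
  obtain ⟨p, hp, hlt⟩ := exists_numbering (IsLeftOf G pos) (fun S hS => by
    by_cases hSi : ∀ i ∈ S, IsItem G i
    · exact h.exists_leftmost S hS hSi
    · push Not at hSi
      obtain ⟨i, hi, hno⟩ := hSi
      exact ⟨i, hi, fun t _ ht => hno ht.2.1⟩)
  have hcard : (Fintype.card (V × V) : ℤ) = (Fintype.card V : ℤ) ^ 2 := by
    rw [Fintype.card_prod]; push_cast; ring
  rw [hcard] at hp
  set I : V → Finset (V × V) := fun v =>
    Finset.univ.filter fun i => IsItem G i ∧ (i.1 = v ∨ i.2 = v) with hI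
  have hvI : ∀ v, (v, v) ∈ I v := fun v =>
    Finset.mem_filter.2 ⟨Finset.mem_univ _, Or.inl rfl, Or.inl rfl⟩
  have hne : ∀ v, (I v).Nonempty := fun v => ⟨_, hvI v⟩
  have hmeet : ∀ {v i}, i ∈ I v → IsItem G i ∧ MeetsRow pos i (pos v).2 ∧
      itemPoint pos i (pos v).2 = (pos v).1 := by
    intro v i hi
    obtain ⟨-, hi', hv⟩ := Finset.mem_filter.1 hi
    have : ((pos i.1).2 : ℝ) ≤ (pos i.2).2 := by exact_mod_cast h.bottom_le_top hi'
    rcases hv with rfl | rfl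
    · exact ⟨hi', ⟨le_rfl, this⟩, itemPoint_bottom i⟩
    · exact ⟨hi', ⟨this, le_rfl⟩, h.itemPoint_top hi'⟩
  have row : ∀ u v, (pos u).2 = (pos v).2 → (pos u).1 < (pos v).1 →
      (I u).sup' (hne u) p < (I v).inf' (hne v) p := by
    intro u v huv hx
    rw [Finset.sup'_lt_iff]
    intro a ha
    rw [Finset.lt_inf'_iff]
    intro b hb
    obtain ⟨ha1, ha2, ha3⟩ := hmeet ha
    obtain ⟨hb1, hb2, hb3⟩ := hmeet hb
    rw [← huv] at hb2 hb3
    refine hlt a b ⟨ha1, hb1, _, ha2, hb2, ?_⟩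
    rw [ha3, hb3]
    exact_mod_cast hx
  have htail : ∀ {v w}, G.Adj v w → (v, w) ∈ I v := fun e =>
    Finset.mem_filter.2 ⟨Finset.mem_univ _, Or.inr e, Or.inl rfl⟩
  have hhead : ∀ {v w}, G.Adj v w → (v, w) ∈ I w := fun e =>
    Finset.mem_filter.2 ⟨Finset.mem_univ _, Or.inr e, Or.inr rfl⟩
  refine ⟨fun v => (I v).inf' (hne v) p, fun v => (I v).sup' (hne v) p, fun v w => p (v, w),
    ⟨fun v => ?_, h.upward, fun v w e => Finset.inf'_le _ (htail e),
      fun v w e => Finset.le_sup' _ (htail e), fun v w e => Finset.inf'_le _ (hhead e),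
      fun v w e => Finset.le_sup' _ (hhead e), fun u v huv hy => ?_, ?_⟩, fun v => ⟨?_, ?_⟩,
    fun v w => hp _⟩
  · exact (Finset.inf'_le _ (hvI v)).trans (Finset.le_sup' _ (hvI v))
  · rcases lt_trichotomy (pos u).1 (pos v).1 with hx | hx | hx
    · exact Or.inl (row u v hy hx)
    · exact (huv (h.planar.vertex_vertex (Prod.ext hx hy))).elim
    · exact Or.inr (row v u hy.symm hx)
  · intro u v w e huv huw h1 h2
    have hm : MeetsRow pos (v, w) (pos u).2 := ⟨by exact_mod_cast h1, by exact_mod_cast h2⟩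
    have hne' : itemPoint pos (v, w) (pos u).2 ≠ (pos u).1 := by
      intro heq
      have h3 := h.itemPoint_mem_edgeSegment (i := (v, w)) e hm
      rw [heq] at h3
      exact h.planar.vertex_edge u v w e huv huw h3
    rcases lt_or_gt_of_ne hne' with hx | hx
    · left
      rw [Finset.lt_inf'_iff]
      intro b hb
      obtain ⟨hb1, hb2, hb3⟩ := hmeet hb
      exact hlt _ _ ⟨Or.inr e, hb1, _, hm, hb2, by rwa [hb3]⟩
    · right
      rw [Finset.sup'_lt_iff]
      intro a ha
      obtain ⟨ha1, ha2, ha3⟩ := hmeet ha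
      exact hlt _ _ ⟨ha1, Or.inr e, _, ha2, hm, by rwa [ha3]⟩
  · rw [Finset.le_inf'_iff]
    exact fun i _ => (hp i).1
  · rw [Finset.sup'_le_iff]
    exact fun i _ => (hp i).2

end IsUpwardDrawing

end Drawing

/-! ### Removal of empty rows -/

theorem IsVisibilityRepresentation.of_le_iff {V : Type*} {G : Digraph V} {y y' L R : V → ℤ}
    {X : V → V → ℤ} (h : IsVisibilityRepresentation G y L R X)
    (hy : ∀ u v, y' u ≤ y' v ↔ y u ≤ y v) : IsVisibilityRepresentation G y' L R X where
  le := h.le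
  upward v w e := by
    rw [← not_le, hy, not_le]
    exact h.upward v w e
  left_le_tail := h.left_le_tail
  tail_le_right := h.tail_le_right
  left_le_head := h.left_le_head
  head_le_right := h.head_le_right
  vertex_vertex u v huv heq := h.vertex_vertex u v huv
    (le_antisymm ((hy u v).1 heq.le) ((hy v u).1 heq.ge))
  vertex_edge u v w e huv huw h1 h2 :=
    h.vertex_edge u v w e huv huw ((hy v u).1 h1) ((hy u w).1 h2)

/-- The number of the row of `v`, if only rows with vertices are counted. -/
def rowRank {V : Type*} [Fintype V] (y : V → ℤ) (v : V) : ℕ :=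
  ((Finset.univ.image y).filter (· ≤ y v)).card

section RowRank

variable {V : Type*} [Fintype V] (y : V → ℤ)

theorem rowRank_pos (v : V) : 0 < rowRank y v :=
  Finset.card_pos.2 ⟨y v, by simp⟩

theorem rowRank_le_card (v : V) : rowRank y v ≤ Fintype.card V :=
  (Finset.card_filter_le _ _).trans Finset.card_image_le

theorem rowRank_le_iff (u v : V) : rowRank y u ≤ rowRank y v ↔ y u ≤ y v := by
  constructor
  · intro h
    by_contra! hlt
    refine absurd h (not_le.2 (Finset.card_lt_card ?_))
    rw [Finset.ssubset_iff_of_subset]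
    · exact ⟨y u, by simp, by simpa using hlt⟩
    · intro r hr
      simp only [Finset.mem_filter] at hr ⊢
      exact ⟨hr.1, hr.2.trans hlt.le⟩
  · intro h
    refine Finset.card_le_card fun r hr => ?_
    simp only [Finset.mem_filter] at hr ⊢
    exact ⟨hr.1, hr.2.trans h⟩

theorem rowRank_le_of_mem_Icc {b : ℤ} {k : ℕ} (h : ∀ v, y v + b ∈ Set.Icc (1 : ℤ) k) (v : V) :
    rowRank y v ≤ k := by
  have h1 : (Finset.univ.image y).filter (· ≤ y v) ⊆ Finset.Icc (1 - b) (k - b) := by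
    intro r hr
    simp only [Finset.mem_filter, Finset.mem_image, Finset.mem_univ, true_and] at hr
    obtain ⟨⟨u, rfl⟩, -⟩ := hr
    have := (h u).1
    have := (h u).2
    rw [Finset.mem_Icc]
    omega
  refine (Finset.card_le_card h1).trans ?_
  rw [Int.card_Icc]
  omega

end RowRank

/-! ### Constraint templates -/

/-- A term `coeff * x^var_{t}` of a constraint that is indexed by a `k`-tuple of vertices, where
the tuple `t` consists of entries of that `k`-tuple. -/
structure LinTerm {m : ℕ} (ar : Fin m → ℕ) (k : ℕ) where
  coeff : Polynomial ℤ
  var : Fin m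
  index : Fin (ar var) → Fin k

/-- A family of constraints: for every tuple of vertices with the given property, the sum of the
terms is at most the right-hand side. -/
structure ConstraintTemplate {m : ℕ} (ar : Fin m → ℕ) where
  arity : ℕ
  guard : VertexPattern (Fin arity) → Prop
  terms : List (LinTerm ar arity)
  rhs : Polynomial ℤ

/-- The pattern of the tuple of vertices that indexes a constraint. -/
def VertexPattern.left {I J : Type} (p : VertexPattern (I ⊕ J)) : VertexPattern I where
  same i j := p.same (Sum.inl i) (Sum.inl j)
  adj i j := p.adj (Sum.inl i) (Sum.inl j)

section Templates

variable {m : ℕ} {ar : Fin m → ℕ}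

open Classical in
/-- The contribution of a term to the coefficient of a variable of the family `f`. -/
noncomputable def LinTerm.contribution {k : ℕ} (τ : LinTerm ar k) (f : Fin m)
    (p : VertexPattern (Fin k ⊕ Fin (ar f))) : Polynomial ℤ :=
  if h : τ.var = f then
    if ∀ j, p.same (Sum.inl (τ.index j)) (Sum.inr (Fin.cast (congrArg ar h) j)) then τ.coeff
    else 0
  else 0

open Classical in
/-- The formulation with the given constraint templates whose objective is the sum of the
variables of the family `o`. -/
noncomputable def IPFormulation.ofTemplates (ar : Fin m → ℕ) (cs : List (ConstraintTemplate ar))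
    (o : Fin m) : IPFormulation where
  numVar := m
  varArity := ar
  numCon := cs.length
  conArity c := (cs.get c).arity
  coeff c f p := if (cs.get c).guard p.left then
    ((cs.get c).terms.map fun τ => τ.contribution f p).sum else 0
  rhs c p := if (cs.get c).guard p then (cs.get c).rhs else 0
  cost f _ := if f = o then 1 else 0

variable {V : Type*}

/-- The variable in a term. -/
def LinTerm.value {k : ℕ} (τ : LinTerm ar k) (x : (Σ f : Fin m, (Fin (ar f) → V)) → ℤ)
    (z : Fin k → V) : ℤ :=
  x ⟨τ.var, z ∘ τ.index⟩

variable [Fintype V]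

theorem LinTerm.sum_contribution_mul (G : Digraph V) {k : ℕ} (τ : LinTerm ar k) (z : Fin k → V)
    (x : (Σ f : Fin m, (Fin (ar f) → V)) → ℤ) (n : ℤ) :
    ∑ i : Σ f : Fin m, (Fin (ar f) → V),
      (τ.contribution i.1 (vertexPattern G (Sum.elim z i.2))).eval n * x i =
    τ.coeff.eval n * τ.value x z := by
  rw [Finset.sum_eq_single ⟨τ.var, z ∘ τ.index⟩]
  · congr 2
    simp [LinTerm.contribution, vertexPattern]
  · rintro ⟨f, t⟩ - hne
    by_cases h1 : τ.var = f
    · subst h1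
      rw [LinTerm.contribution, dif_pos rfl]
      split_ifs with h2
      · exact (hne (Sigma.ext rfl (heq_of_eq (funext fun j => (h2 j).symm)))).elim
      · simp
    · rw [LinTerm.contribution, dif_neg h1]
      simp
  · intro h
    exact (h (Finset.mem_univ _)).elim

open Classical in
-- A tuple that fails the guard contributes the void constraint `0 ≤ 0`.
theorem isFeasible_ofTemplates_iff (G : Digraph V) (cs : List (ConstraintTemplate ar)) (o : Fin m)
    (x : (Σ f : Fin m, (Fin (ar f) → V)) → ℤ) :
    ((IPFormulation.ofTemplates ar cs o).program G).IsFeasible x ↔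
      ∀ T ∈ cs, ∀ z : Fin T.arity → V, T.guard (vertexPattern G z) →
        (T.terms.map fun τ => τ.coeff.eval (Fintype.card V : ℤ) * τ.value x z).sum ≤
          T.rhs.eval (Fintype.card V : ℤ) := by
  have key : ∀ (c : Fin cs.length) (z : Fin (cs.get c).arity → V),
      (cs.get c).guard (vertexPattern G z) →
      ((IPFormulation.ofTemplates ar cs o).program G).A.mulVec x ⟨c, z⟩ =
        ((cs.get c).terms.map fun τ => τ.coeff.eval (Fintype.card V : ℤ) * τ.value x z).sum := by
    intro c z hz
    have hcoeff : ∀ i : Σ f : Fin m, (Fin (ar f) → V),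
        ((IPFormulation.ofTemplates ar cs o).program G).A ⟨c, z⟩ i =
        ((cs.get c).terms.map fun τ => (τ.contribution i.1
          (vertexPattern G (Sum.elim z i.2))).eval (Fintype.card V : ℤ)).sum := by
      intro i
      have h1 : (cs.get c).guard (vertexPattern G (Sum.elim z i.2)).left := hz
      change Polynomial.eval _ (if (cs.get c).guard (vertexPattern G (Sum.elim z i.2)).left then
        ((cs.get c).terms.map fun τ =>
          τ.contribution i.1 (vertexPattern G (Sum.elim z i.2))).sum else 0) = _
      rw [if_pos h1, ← Polynomial.coe_evalRingHom, map_list_sum, List.map_map]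
      rfl
    change ∑ i : Σ f : Fin m, (Fin (ar f) → V), _ * x i = _
    simp only [hcoeff]
    generalize (cs.get c).terms = l
    induction l with
    | nil => simp
    | cons τ l ih =>
      simp only [List.map_cons, List.sum_cons, add_mul, Finset.sum_add_distrib, ih,
        LinTerm.sum_contribution_mul]
  have key' : ∀ (c : Fin cs.length) (z : Fin (cs.get c).arity → V),
      (((IPFormulation.ofTemplates ar cs o).program G).A.mulVec x ⟨c, z⟩ ≤
        ((IPFormulation.ofTemplates ar cs o).program G).b ⟨c, z⟩ ↔
      ((cs.get c).guard (vertexPattern G z) →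
        ((cs.get c).terms.map fun τ => τ.coeff.eval (Fintype.card V : ℤ) * τ.value x z).sum ≤
          (cs.get c).rhs.eval (Fintype.card V : ℤ))) := by
    intro c z
    by_cases hz : (cs.get c).guard (vertexPattern G z)
    · rw [key c z hz]
      have : ((IPFormulation.ofTemplates ar cs o).program G).b ⟨c, z⟩ =
          (cs.get c).rhs.eval (Fintype.card V : ℤ) := by
        change Polynomial.eval _ (if (cs.get c).guard (vertexPattern G z) then _ else 0) = _
        rw [if_pos hz]
      rw [this]
      exact ⟨fun h _ => h, fun h => h hz⟩
    · refine iff_of_true ?_ fun h => absurd h hz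
      have h1 : ((IPFormulation.ofTemplates ar cs o).program G).b ⟨c, z⟩ = 0 := by
        change Polynomial.eval _ (if (cs.get c).guard (vertexPattern G z) then _ else 0) = _
        rw [if_neg hz, Polynomial.eval_zero]
      rw [h1]
      refine le_of_eq (Finset.sum_eq_zero fun i _ => ?_)
      have h2 : ¬ (cs.get c).guard (vertexPattern G (Sum.elim z i.2)).left := hz
      change Polynomial.eval _ (if (cs.get c).guard (vertexPattern G (Sum.elim z i.2)).left then
        _ else 0) * _ = 0
      rw [if_neg h2, Polynomial.eval_zero, zero_mul]
  constructor
  · intro h T hT z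
    obtain ⟨c, rfl⟩ := List.get_of_mem hT
    exact (key' c z).1 (h ⟨c, z⟩)
  · rintro h ⟨c, z⟩
    exact (key' c z).2 (h _ (List.get_mem _ _) z)

theorem objective_ofTemplates (G : Digraph V) (cs : List (ConstraintTemplate ar)) {o : Fin m}
    (ho : ar o = 0) (x : (Σ f : Fin m, (Fin (ar f) → V)) → ℤ) :
    ((IPFormulation.ofTemplates ar cs o).program G).objective x =
      x ⟨o, fun j => (Fin.cast ho j).elim0⟩ := by
  change ∑ i : Σ f : Fin m, (Fin (ar f) → V),
    Polynomial.eval _ (if i.1 = o then (1 : Polynomial ℤ) else 0) * x i = _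
  rw [Finset.sum_eq_single ⟨o, fun j => (Fin.cast ho j).elim0⟩]
  · simp
  · rintro ⟨f, t⟩ - hne
    rw [if_neg, Polynomial.eval_zero, zero_mul]
    rintro rfl
    exact hne (Sigma.ext rfl (heq_of_eq (funext fun j => (Fin.cast ho j).elim0)))
  · intro h
    exact (h (Finset.mem_univ _)).elim

theorem card_sigma_tuples_le {l k : ℕ} (a : Fin l → ℕ) (ha : ∀ i, a i ≤ k)
    (hV : 1 ≤ Fintype.card V) :
    Fintype.card (Σ i : Fin l, (Fin (a i) → V)) ≤ l * Fintype.card V ^ k := by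
  rw [Fintype.card_sigma]
  refine (Finset.sum_le_card_nsmul _ _ (Fintype.card V ^ k) fun i _ => ?_).trans ?_
  · rw [Fintype.card_fun, Fintype.card_fin]
    exact Nat.pow_le_pow_right hV (ha i)
  · simp

end Templates

/-! ### The formulation by visibility representations -/

/-- The families of variables: the height, the rows of the vertices, the left and right ends of the
vertices, the columns of the edges, and indicators for `u` below `v`, `u` to the left of `v`, the
edge `v → w` to the left of `u`, and the edge `v → w` to the right of `u`. -/
def visibilityArity : Fin 9 → ℕ := ![0, 1, 1, 1, 2, 2, 2, 3, 3]

section Terms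

open Polynomial

variable {k : ℕ}

/-- A multiple of the height. -/
def heightTerm (c : ℤ[X]) : LinTerm visibilityArity k :=
  ⟨c, 0, fun j => (Fin.cast rfl j : Fin 0).elim0⟩

/-- A multiple of a variable of one vertex. -/
def unaryTerm (c : ℤ[X]) (f : Fin 9) (a : Fin k) : LinTerm visibilityArity k :=
  ⟨c, f, fun _ => a⟩

/-- A multiple of a variable of a pair of vertices. -/
def binaryTerm (c : ℤ[X]) (f : Fin 9) (hf : visibilityArity f = 2) (a b : Fin k) :
    LinTerm visibilityArity k :=
  ⟨c, f, fun j => ![a, b] (Fin.cast hf j)⟩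

/-- A multiple of a variable of a triple of vertices. -/
def ternaryTerm (c : ℤ[X]) (f : Fin 9) (hf : visibilityArity f = 3) (a₁ a₂ a₃ : Fin k) :
    LinTerm visibilityArity k :=
  ⟨c, f, fun j => ![a₁, a₂, a₃] (Fin.cast hf j)⟩

/-- A number that exceeds all differences of coordinates. -/
noncomputable def bigM : ℤ[X] := X ^ 2 + 2

/-- The constraints of a visibility representation. -/
noncomputable def visibilityConstraints : List (ConstraintTemplate visibilityArity) :=
  -- With a vertex present this follows from the row constraints; it keeps the objective bounded for
  -- the empty graph.
  [⟨0, fun _ => True, [heightTerm (-1)], 0⟩,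
   ⟨1, fun _ => True, [unaryTerm 1 1 0, heightTerm (-1)], 0⟩,
   ⟨1, fun _ => True, [unaryTerm (-1) 1 0], -1⟩,
   ⟨1, fun _ => True, [unaryTerm 1 2 0, unaryTerm (-1) 3 0], 0⟩,
   ⟨2, fun p => p.adj 0 1, [unaryTerm 1 1 0, unaryTerm (-1) 1 1], -1⟩,
   ⟨2, fun p => p.adj 0 1, [unaryTerm 1 2 0, binaryTerm (-1) 4 (by decide) 0 1], 0⟩,
   ⟨2, fun p => p.adj 0 1, [binaryTerm 1 4 (by decide) 0 1, unaryTerm (-1) 3 0], 0⟩,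
   ⟨2, fun p => p.adj 0 1, [unaryTerm 1 2 1, binaryTerm (-1) 4 (by decide) 0 1], 0⟩,
   ⟨2, fun p => p.adj 0 1, [binaryTerm 1 4 (by decide) 0 1, unaryTerm (-1) 3 1], 0⟩,
   -- An indicator equal to one forces a difference of at most `-1`; an indicator equal to zero
   -- leaves it free up to `bigM - 1`.
   ⟨2, fun _ => True, [unaryTerm 1 1 0, unaryTerm (-1) 1 1, binaryTerm bigM 5 (by decide) 0 1], bigM - 1⟩,
   ⟨2, fun _ => True, [unaryTerm 1 3 0, unaryTerm (-1) 2 1, binaryTerm bigM 6 (by decide) 0 1], bigM - 1⟩,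
   ⟨2, fun p => ¬ p.same 0 1, [binaryTerm (-1) 5 (by decide) 0 1, binaryTerm (-1) 5 (by decide) 1 0,
      binaryTerm (-1) 6 (by decide) 0 1, binaryTerm (-1) 6 (by decide) 1 0], -1⟩,
   ⟨3, fun p => p.adj 0 1, [binaryTerm 1 4 (by decide) 0 1, unaryTerm (-1) 2 2,
      ternaryTerm bigM 7 (by decide) 0 1 2], bigM - 1⟩,
   ⟨3, fun p => p.adj 0 1, [unaryTerm 1 3 2, binaryTerm (-1) 4 (by decide) 0 1,
      ternaryTerm bigM 8 (by decide) 0 1 2], bigM - 1⟩,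
   ⟨3, fun p => p.adj 0 1 ∧ ¬ p.same 2 0 ∧ ¬ p.same 2 1, [binaryTerm (-1) 5 (by decide) 2 0,
      binaryTerm (-1) 5 (by decide) 1 2, ternaryTerm (-1) 7 (by decide) 0 1 2, ternaryTerm (-1) 8 (by decide) 0 1 2], -1⟩]

/-- The integer programming formulation for minimum-height upward drawings. -/
noncomputable def visibilityFormulation : IPFormulation :=
  IPFormulation.ofTemplates visibilityArity visibilityConstraints 0

end Terms

/-- The constraints of a visibility representation, as inequalities. -/
structure IsVisibilitySolution {V : Type*} (G : Digraph V) (M H : ℤ) (Y L R : V → ℤ)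
    (X below leftOf : V → V → ℤ) (edgeLeft edgeRight : V → V → V → ℤ) : Prop where
  height_nonneg : 0 ≤ H
  row_le : ∀ v, Y v ≤ H
  one_le_row : ∀ v, 1 ≤ Y v
  left_le_right : ∀ v, L v ≤ R v
  upward : ∀ v w, G.Adj v w → Y v + 1 ≤ Y w
  left_le_tail : ∀ v w, G.Adj v w → L v ≤ X v w
  tail_le_right : ∀ v w, G.Adj v w → X v w ≤ R v
  left_le_head : ∀ v w, G.Adj v w → L w ≤ X v w
  head_le_right : ∀ v w, G.Adj v w → X v w ≤ R w
  row_lt : ∀ u v, Y u - Y v + M * below u v ≤ M - 1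
  right_lt : ∀ u v, R u - L v + M * leftOf u v ≤ M - 1
  vertex_vertex : ∀ u v, u ≠ v → 1 ≤ below u v + below v u + leftOf u v + leftOf v u
  edge_lt : ∀ v w u, G.Adj v w → X v w - L u + M * edgeLeft v w u ≤ M - 1
  edge_gt : ∀ v w u, G.Adj v w → R u - X v w + M * edgeRight v w u ≤ M - 1
  vertex_edge : ∀ v w u, G.Adj v w → u ≠ v → u ≠ w →
    1 ≤ below u v + below w u + edgeLeft v w u + edgeRight v w u

section Feasible

variable {V : Type*} (x : visibilityFormulation.Var V → ℤ)

/-- The variables that belong to a pair of vertices. -/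
def binaryValue (f : Fin 9) (hf : visibilityArity f = 2) (v w : V) : ℤ :=
  x ⟨f, fun j => ![v, w] (Fin.cast hf j)⟩

/-- The variables that belong to a triple of vertices. -/
def ternaryValue (f : Fin 9) (hf : visibilityArity f = 3) (v w u : V) : ℤ :=
  x ⟨f, fun j => ![v, w, u] (Fin.cast hf j)⟩

/-- The height variable. -/
def heightValue : ℤ :=
  x ⟨(0 : Fin 9), fun j => (Fin.cast rfl j : Fin 0).elim0⟩

/-- The variables that belong to a vertex. -/
def unaryValue (f : Fin 9) (v : V) : ℤ :=
  x ⟨f, fun _ => v⟩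

variable {k : ℕ} (c : Polynomial ℤ) (z : Fin k → V)

theorem heightTerm_value : (heightTerm c).value x z = heightValue x := by
  refine congrArg (fun t => x ⟨(0 : Fin 9), t⟩) (funext fun j => ?_)
  exact (Fin.cast rfl j : Fin 0).elim0

theorem unaryTerm_value (f : Fin 9) (a : Fin k) :
    (unaryTerm c f a).value x z = unaryValue x f (z a) := rfl

theorem binaryTerm_value (f : Fin 9) (hf : visibilityArity f = 2) (a b : Fin k) :
    (binaryTerm c f hf a b).value x z = binaryValue x f hf (z a) (z b) := by
  refine congrArg (fun t => x ⟨f, t⟩) (funext fun j => ?_)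
  change z (![a, b] (Fin.cast hf j)) = ![z a, z b] (Fin.cast hf j)
  generalize Fin.cast hf j = i
  fin_cases i <;> rfl

theorem ternaryTerm_value (f : Fin 9) (hf : visibilityArity f = 3) (a₁ a₂ a₃ : Fin k) :
    (ternaryTerm c f hf a₁ a₂ a₃).value x z = ternaryValue x f hf (z a₁) (z a₂) (z a₃) := by
  refine congrArg (fun t => x ⟨f, t⟩) (funext fun j => ?_)
  change z (![a₁, a₂, a₃] (Fin.cast hf j)) = ![z a₁, z a₂, z a₃] (Fin.cast hf j)
  generalize Fin.cast hf j = i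
  fin_cases i <;> rfl

variable [Fintype V] (G : Digraph V)

theorem isFeasible_visibilityFormulation_iff :
    (visibilityFormulation.program G).IsFeasible x ↔
      IsVisibilitySolution G ((Fintype.card V : ℤ) ^ 2 + 2) (heightValue x) (unaryValue x 1)
        (unaryValue x 2) (unaryValue x 3) (binaryValue x 4 rfl) (binaryValue x 5 rfl)
        (binaryValue x 6 rfl) (ternaryValue x 7 rfl) (ternaryValue x 8 rfl) := by
  refine (isFeasible_ofTemplates_iff G visibilityConstraints 0 x).trans ?_
  have hM : bigM.eval (Fintype.card V : ℤ) = (Fintype.card V : ℤ) ^ 2 + 2 := by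
    simp [bigM]
  simp only [visibilityConstraints, List.forall_mem_cons, List.not_mem_nil, IsEmpty.forall_iff,
    implies_true, and_true, List.map_cons, List.map_nil, List.sum_cons, List.sum_nil, add_zero,
    heightTerm_value, unaryTerm_value, binaryTerm_value, ternaryTerm_value]
  simp only [heightTerm, unaryTerm, binaryTerm, ternaryTerm, hM, Polynomial.eval_neg,
    Polynomial.eval_one, Polynomial.eval_zero, Polynomial.eval_sub, vertexPattern, forall_const]
  constructor
  · rintro ⟨h0, h1, h2, h3, h4, h5, h6, h7, h8, h9, h10, h11, h12, h13, h14⟩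
    constructor
    · linarith
    · intro v; have := h1 ![v]; simp at this; linarith
    · intro v; have := h2 ![v]; simp at this; linarith
    · intro v; have := h3 ![v]; simp at this; linarith
    · intro v w e; have := h4 ![v, w] e; simp at this; linarith
    · intro v w e; have := h5 ![v, w] e; simp at this; linarith
    · intro v w e; have := h6 ![v, w] e; simp at this; linarith
    · intro v w e; have := h7 ![v, w] e; simp at this; linarith
    · intro v w e; have := h8 ![v, w] e; simp at this; linarith
    · intro v w; have := h9 ![v, w]; simp at this; linarith
    · intro v w; have := h10 ![v, w]; simp at this; linarith
    · intro v w e; have := h11 ![v, w] e; simp at this; linarith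
    · intro v w u e; have := h12 ![v, w, u] e; simp at this; linarith
    · intro v w u e; have := h13 ![v, w, u] e; simp at this; linarith
    · intro v w u e h1 h2; have := h14 ![v, w, u] ⟨e, h1, h2⟩; simp at this; linarith
  · intro h
    refine ⟨?_, fun z => ?_, fun z => ?_, fun z => ?_, fun z e => ?_, fun z e => ?_,
      fun z e => ?_, fun z e => ?_, fun z e => ?_, fun z => ?_, fun z => ?_, fun z e => ?_,
      fun z e => ?_, fun z e => ?_, fun z e => ?_⟩
    · linarith [h.height_nonneg]
    · linarith [h.row_le (z 0)]
    · linarith [h.one_le_row (z 0)]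
    · linarith [h.left_le_right (z 0)]
    · linarith [h.upward _ _ e]
    · linarith [h.left_le_tail _ _ e]
    · linarith [h.tail_le_right _ _ e]
    · linarith [h.left_le_head _ _ e]
    · linarith [h.head_le_right _ _ e]
    · linarith [h.row_lt (z 0) (z 1)]
    · linarith [h.right_lt (z 0) (z 1)]
    · linarith [h.vertex_vertex _ _ e]
    · linarith [h.edge_lt _ _ (z 2) e]
    · linarith [h.edge_gt _ _ (z 2) e]
    · linarith [h.vertex_edge _ _ (z 2) e.1 e.2.1 e.2.2]

theorem objective_visibilityFormulation :
    (visibilityFormulation.program G).objective x = heightValue x :=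
  objective_ofTemplates G visibilityConstraints rfl x

end Feasible

/-! ### Feasible solutions and drawings -/

section Solutions

variable {V : Type*} {G : Digraph V}

/-- The indicators need no bounds: integers whose sum is at least one include one that is at least
one, and any such value already forces its strict inequality. -/
theorem IsVisibilitySolution.isVisibilityRepresentation {M H : ℤ} {Y L R : V → ℤ}
    {X below leftOf : V → V → ℤ} {edgeLeft edgeRight : V → V → V → ℤ} (hM : 0 ≤ M)
    (h : IsVisibilitySolution G M H Y L R X below leftOf edgeLeft edgeRight) :
    IsVisibilityRepresentation G Y L R X := by
  have big : ∀ {d b : ℤ}, d + M * b ≤ M - 1 → 1 ≤ b → d < 0 := by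
    intro d b h1 h2
    have := mul_le_mul_of_nonneg_left h2 hM
    linarith
  refine ⟨h.left_le_right, fun v w e => by have := h.upward v w e; omega, h.left_le_tail,
    h.tail_le_right, h.left_le_head, h.head_le_right, fun u v huv hy => ?_,
    fun u v w e huv huw h1 h2 => ?_⟩
  · have h3 := h.vertex_vertex u v huv
    have h4 := big (h.row_lt u v)
    have h5 := big (h.row_lt v u)
    have h6 := big (h.right_lt u v)
    have h7 := big (h.right_lt v u)
    omega
  · have h3 := h.vertex_edge v w u e huv huw
    have h4 := big (h.row_lt u v)
    have h5 := big (h.row_lt w u)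
    have h6 := big (h.edge_lt v w u e)
    have h7 := big (h.edge_gt v w u e)
    omega

/-- The values of the variables, family by family. -/
def visibilityAssignment (H : ℤ) (Y L R : V → ℤ) (X below leftOf : V → V → ℤ)
    (edgeLeft edgeRight : V → V → V → ℤ) : visibilityFormulation.Var V → ℤ := fun i =>
  (show (f : Fin 9) → (Fin (visibilityArity f) → V) → ℤ from fun f => match f with
    | 0 => fun _ => H
    | 1 => fun t => Y (t (0 : Fin 1))
    | 2 => fun t => L (t (0 : Fin 1))
    | 3 => fun t => R (t (0 : Fin 1))
    | 4 => fun t => X (t (0 : Fin 2)) (t (1 : Fin 2))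
    | 5 => fun t => below (t (0 : Fin 2)) (t (1 : Fin 2))
    | 6 => fun t => leftOf (t (0 : Fin 2)) (t (1 : Fin 2))
    | 7 => fun t => edgeLeft (t (0 : Fin 3)) (t (1 : Fin 3)) (t (2 : Fin 3))
    | 8 => fun t => edgeRight (t (0 : Fin 3)) (t (1 : Fin 3)) (t (2 : Fin 3))) i.1 i.2

/-- The indicators are truth values. Differences of coordinates are at most `n ^ 2`, so a false
indicator imposes nothing. -/
theorem IsVisibilityRepresentation.exists_isFeasible [Fintype V] {Y L R : V → ℤ}
    {X : V → V → ℤ} (h : IsVisibilityRepresentation G Y L R X) {H : ℤ} (hH : 0 ≤ H)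
    (hY : ∀ v, 1 ≤ Y v ∧ Y v ≤ H ∧ Y v ≤ Fintype.card V)
    (hLR : ∀ v, 0 ≤ L v ∧ R v ≤ (Fintype.card V : ℤ) ^ 2)
    (hX : ∀ v w, 0 ≤ X v w ∧ X v w ≤ (Fintype.card V : ℤ) ^ 2) :
    ∃ x : visibilityFormulation.Var V → ℤ,
      (visibilityFormulation.program G).IsFeasible x ∧ heightValue x = H := by
  have indicator : ∀ {d : ℤ} {P : Prop} [Decidable P], d ≤ (Fintype.card V : ℤ) ^ 2 → (P → d < 0) →
      d + ((Fintype.card V : ℤ) ^ 2 + 2) * (if P then 1 else 0) ≤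
        (Fintype.card V : ℤ) ^ 2 + 2 - 1 := by
    intro d P _ h1 h2
    split_ifs with hP
    · have := h2 hP
      linarith
    · linarith
  have hn : (Fintype.card V : ℤ) ≤ (Fintype.card V : ℤ) ^ 2 := by
    exact_mod_cast Nat.le_self_pow two_ne_zero _
  refine ⟨visibilityAssignment H Y L R X (fun u v => if Y u < Y v then 1 else 0)
    (fun u v => if R u < L v then 1 else 0) (fun v w u => if X v w < L u then 1 else 0)
    (fun v w u => if R u < X v w then 1 else 0),
    (isFeasible_visibilityFormulation_iff _ G).2 ?_, rfl⟩
  change IsVisibilitySolution G _ H Y L R X (fun u v => if Y u < Y v then 1 else 0)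
    (fun u v => if R u < L v then 1 else 0) (fun v w u => if X v w < L u then 1 else 0)
    (fun v w u => if R u < X v w then 1 else 0)
  refine ⟨hH, fun v => (hY v).2.1, fun v => (hY v).1, h.le, h.upward, h.left_le_tail,
    h.tail_le_right, h.left_le_head, h.head_le_right, fun u v => indicator ?_ sub_neg.2,
    fun u v => indicator ?_ sub_neg.2, fun u v huv => ?_, fun v w u _ => indicator ?_ sub_neg.2,
    fun v w u _ => indicator ?_ sub_neg.2, fun v w u e huv huw => ?_⟩
  · linarith [(hY u).2.2, (hY v).1]
  · linarith [(hLR u).2, (hLR v).1]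
  · have := h.vertex_vertex u v huv
    split_ifs <;> omega
  · linarith [(hX v w).2, (hLR u).1]
  · linarith [(hLR u).2, (hX v w).1]
  · have := h.vertex_edge u v w e huv huw
    split_ifs <;> omega

/-- Rows are renumbered in the visibility representation and not in the straight-line drawing, whose
planarity need not survive this. -/
theorem IsUpwardDrawing.exists_isFeasible [Fintype V] {pos : V → ℤ × ℤ}
    (h : IsUpwardDrawing G pos) {H : ℕ} (hH : ∀ v, rowRank (fun v => (pos v).2) v ≤ H) :
    ∃ x : visibilityFormulation.Var V → ℤ,
      (visibilityFormulation.program G).IsFeasible x ∧ heightValue x = H := by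
  obtain ⟨L, R, X, hrep, hLR, hX⟩ := h.exists_isVisibilityRepresentation
  refine (hrep.of_le_iff (y' := fun v => (rowRank (fun v => (pos v).2) v : ℤ)) fun u v => by
    rw [Nat.cast_le, rowRank_le_iff]).exists_isFeasible (Nat.cast_nonneg H)
    (fun v => ⟨?_, ?_, ?_⟩) hLR hX
  · exact_mod_cast rowRank_pos _ v
  · exact_mod_cast hH v
  · exact_mod_cast rowRank_le_card _ v

theorem exists_isUpwardDrawing_of_isFeasible [Fintype V] {x : visibilityFormulation.Var V → ℤ}
    (hx : (visibilityFormulation.program G).IsFeasible x) :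
    0 ≤ heightValue x ∧ ∃ (pos : V → ℤ × ℤ) (w : ℕ), IsUpwardDrawing G pos ∧
      FitsGrid pos w (heightValue x).toNat ∧ (∀ v, (pos v).2 = unaryValue x 1 v) ∧
      ∀ u v, (pos u).2 = (pos v).2 →
        ((pos u).1 < (pos v).1 ↔ unaryValue x 2 u < unaryValue x 2 v) := by
  have h := (isFeasible_visibilityFormulation_iff x G).1 hx
  have hrep := h.isVisibilityRepresentation (by positivity)
  obtain ⟨pos, hpos, hy, hx⟩ := hrep.exists_isUpwardDrawing
  obtain ⟨B, hB⟩ := (Set.finite_range fun v => |(pos v).1|).bddAbove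
  refine ⟨h.height_nonneg, pos, (2 * B + 1).toNat, hpos, ⟨B + 1, 0, fun v => ⟨?_, ?_⟩⟩, hy,
    fun u v huv => hx u v (by rw [← hy, ← hy, huv])⟩
  · obtain ⟨h1, h2⟩ := abs_le.1 (hB ⟨v, rfl⟩ : |(pos v).1| ≤ B)
    constructor <;> omega
  · have h1 := h.one_le_row v
    have h2 := h.row_le v
    have h3 := h.height_nonneg
    rw [hy]
    constructor <;> omega

end Solutions

/-! ### The main theorem -/

theorem mainTheorem12 :
    ∃ (S : IPFormulation) (X Y : Fin S.numVar) (C : ℕ),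
      ∀ (V : Type*) [Fintype V] (G : Digraph V), IsDAG G →
        -- the program has `O(n³)` variables and constraints
        (1 ≤ Fintype.card V →
          Fintype.card (S.Var V) ≤ C * Fintype.card V ^ 3 ∧
          Fintype.card (S.Con V) ≤ C * Fintype.card V ^ 3) ∧
        -- it tests whether `G` has an upward planar drawing
        ((∃ x : S.Var V → ℤ, (S.program G).IsFeasible x) ↔ HasUpwardDrawing G) ∧
        -- it finds a minimum-height upward drawing, if there is an upward drawing at all
        (HasUpwardDrawing G → ∃ x : S.Var V → ℤ, (S.program G).IsOptimal x) ∧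
        (∀ x : S.Var V → ℤ, (S.program G).IsOptimal x →
          ∃ h : ℕ, (S.program G).objective x = (h : ℤ) ∧
            IsLeast {k : ℕ | HasUpwardDrawingOfHeight G k} h ∧
            ∃ (pos : V → ℤ × ℤ) (w : ℕ), IsUpwardDrawing G pos ∧ FitsGrid pos w h ∧
              (∀ v : V, (pos v).2 = x (S.vertexVar Y v)) ∧
              (∀ u v : V, (pos u).2 = (pos v).2 →
                ((pos u).1 < (pos v).1 ↔ x (S.vertexVar X u) < x (S.vertexVar X v)))) := by
  -- Left ends serve as `X` and rows as `Y`. There are 9 families of variables and 15 of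
  -- constraints, all indexed by at most three vertices, hence the constant 15.
  refine ⟨visibilityFormulation, (2 : Fin 9), (1 : Fin 9), 15, fun V _ G _ =>
    ⟨fun hV => ⟨?_, ?_⟩, ⟨?_, ?_⟩, ?_, ?_⟩⟩
  · have h1 := card_sigma_tuples_le (V := V) (k := 3) visibilityArity (by decide) hV
    exact h1.trans (Nat.mul_le_mul_right _ (by norm_num))
  · have h1 : ∀ T ∈ visibilityConstraints, T.arity ≤ 3 := by
      simp [visibilityConstraints]
    exact card_sigma_tuples_le (V := V) (k := 3) (fun c => (visibilityConstraints.get c).arity)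
      (fun c => h1 _ (List.get_mem _ _)) hV
  · rintro ⟨x, hx⟩
    obtain ⟨-, pos, -, hpos, -⟩ := exists_isUpwardDrawing_of_isFeasible hx
    exact ⟨pos, hpos⟩
  · rintro ⟨pos, hpos⟩
    obtain ⟨x, hx, -⟩ := hpos.exists_isFeasible (rowRank_le_card _)
    exact ⟨x, hx⟩
  · rintro ⟨pos, hpos⟩
    obtain ⟨x, hx, -⟩ := hpos.exists_isFeasible (rowRank_le_card _)
    obtain ⟨m, ⟨x₀, hx₀, rfl⟩, hm⟩ := Int.exists_least_of_bdd
      (P := fun m => ∃ x, (visibilityFormulation.program G).IsFeasible x ∧ heightValue x = m)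
      ⟨0, by
        rintro m ⟨x, hx, rfl⟩
        exact (exists_isUpwardDrawing_of_isFeasible hx).1⟩ ⟨_, x, hx, rfl⟩
    refine ⟨x₀, hx₀, fun x' hx' => ?_⟩
    rw [objective_visibilityFormulation, objective_visibilityFormulation]
    exact hm _ ⟨x', hx', rfl⟩
  · rintro x ⟨hx, hmin⟩
    obtain ⟨h0, pos, w, hpos, hfit, hY, hX⟩ := exists_isUpwardDrawing_of_isFeasible hx
    refine ⟨(heightValue x).toNat, ?_, ⟨⟨pos, w, hpos, hfit⟩, ?_⟩, pos, w, hpos, hfit, hY, hX⟩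
    · rw [objective_visibilityFormulation, Int.toNat_of_nonneg h0]
    · rintro k ⟨pos', w', hpos', a, b, hab⟩
      -- A drawing on `k` rows has at most `k` nonempty ones, so it yields a feasible solution of
      -- value exactly `k`.
      obtain ⟨x', hx', hk⟩ := hpos'.exists_isFeasible
        (rowRank_le_of_mem_Icc _ fun v => (hab v).2)
      have h1 := hmin x' hx'
      rw [objective_visibilityFormulation, objective_visibilityFormulation, hk] at h1
      omega
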